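/- \textbf{Setting.} Let $x_1,\dots,x_n$ be variables with non-empty finite domains. For $s\in\mathrm{dom}(x_i)$ let $[\![x_i=s]\!]$ be a boolean variable (a \emph{domain variable}); let $\mathrm{dvar}(x_i)$ be the set of the domain variables of $x_i$ and $\mathrm{dvar}(\mathbf x)$ the set of all of them. An \emph{NNF} $D$ is a finite rooted DAG with node set $V$ and root $\rho$ (every node is reachable from $\rho$). Its inner nodes are labeled $\wedge$ or $\vee$, and an edge $(v,u)$ goes from an inner node $v$ to one of its inputs $u$. Its leaves are distinct domain variables (there are no constant leaves), and for each $i$ at least one element of $\mathrm{dvar}(x_i)$ is a leaf. Let $\mathrm{var}(v)$ be the set of the $x_i$ such that a leaf in $\mathrm{dvar}(x_i)$ is reachable from $v$. $D$ is a \emph{smooth DNNF} if the inputs of each $\wedge$-node have pairwise disjoint sets $\mathrm{var}$, and $\mathrm{var}(v)=\mathrm{var}(u)$ for each input $u$ of each $\vee$-node $v$. Let $f_D(\mathrm{dvar}(\mathbf x))$ be the monotone boolean function computed at $\rho$, and let $f'_D$ be the conjunction of $f_D$ with the constraints ``exactly one element of $\mathrm{dvar}(x_i)$ is true'', $i=1,\dots,n$.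 Let $H_i=\{v\in V: x_i\in\mathrm{var}(v)\}$, let $L_i$ be the set of leaves in $H_i$, and let $D_i$ be the subgraph of $D$ induced by $H_i$. A set $S\subseteq H_i$ is a \emph{separator} in $D_i$ if every directed path in $D_i$ from $\rho$ to a leaf contains exactly one node of $S$. Assume that $D$ is covered by separators: for each $i$ we are given a collection $\mathcal S_i$ of separators in $D_i$ with $\bigcup_{S\in\mathcal S_i}S=H_i\setminus\{\rho\}$. \textbf{Encodings.} A CNF formula $\varphi(\mathbf x,\mathbf y)$ is an \emph{encoding} of a boolean function $f(\mathbf x)$ if $f(\mathbf a)=(\exists\mathbf b)\,\varphi(\mathbf a,\mathbf b)$ for every full assignment $\mathbf a$ of $\mathbf x$. A partial assignment is a set of literals without a complementary pair, identified with their conjunction. Write $\vdash_1$ for derivability by unit resolution (from a clause $C$ and a unit clause $\neg l$ derive $C\setminus\{l\}$). The encoding $\varphi$ is a \emph{URC encoding} if for every partial assignment $\alpha$ of $\mathbf x\cup\mathbf y$, $\varphi\wedge\alpha\models\bot$ implies $\varphi\wedge\alpha\vdash_1\bot$. It is a \emph{PC encoding} if for every such $\alpha$ and every literal $l$ on $\mathbf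 x\cup\mathbf y$, $\varphi\wedge\alpha\models l$ implies $\varphi\wedge\alpha\vdash_1 l$ or $\varphi\wedge\alpha\vdash_1\bot$. \textbf{At-most-one and exactly-one.} For a set $S$ of variables, $\mathrm{amo}^*(S)$ is the set of all prime implicates of ``at most one variable of $S$ is true'', and $\mathrm{eo}^*(S)=\mathrm{amo}^*(S)\wedge\bigvee_{x\in S}x$. The sequential encoding $\mu_n(x_1,\dots,x_n)$ is empty for $n=1$, consists of the clauses $\neg x_j\vee\neg x_k$ ($j<k$) for $n=2,3$, and for $n\ge4$ is $$(\neg x_1\vee\neg x_2)(\neg x_1\vee y)(\neg x_2\vee y)\wedge\mu_{n-1}(y,x_3,\dots,x_n),$$ where $y$ is a new auxiliary variable. The splitting encoding $\epsilon_n$ consists, for $n\le3$, of all clauses $\neg x_j\vee\neg x_k$ ($j<k$) and the clause $x_1\vee\dots\vee x_n$; the same clauses with literals in place of the variables define $\epsilon_3$ on literals. For $n\ge4$, $$\epsilon_n(x_1,\dots,x_n)=\epsilon_3(x_1,x_2,\neg y_1)\wedge\epsilon_3(y_1,x_3,\neg y_2)\wedge\dots\wedge\epsilon_3(y_{n-4},x_{n-2},\neg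 y_{n-3})\wedge\epsilon_3(y_{n-3},x_{n-1},x_n),$$ where $y_1,\dots,y_{n-3}$ are new auxiliary variables. \textbf{The formulas.} The nodes of $D$ are used as boolean variables; let $\mathbf v$ be the vector of inner nodes (the leaves are elements of $\mathrm{dvar}(\mathbf x)$). Let $B$ consist of the unit clause $\rho$ and the clauses \begin{itemize} \item N1: $v\to v_1\vee\dots\vee v_k$ for each $\vee$-node $v$ with inputs $v_1,\dots,v_k$; \item N2: $v\to v_j$ for each $\wedge$-node $v$ and each input $v_j$ of $v$; \item N3: $v\to p_1\vee\dots\vee p_k$ for each node $v$ with incoming edges, these being from $p_1,\dots,p_k$; \item N4: $\neg l$ for each $l\in\mathrm{dvar}(x_i)\setminus L_i$, $i=1,\dots,n$. \end{itemize} Let $S$ range over all separators in $\mathcal S_1\cup\dots\cup\mathcal S_n$, and put $$\psi_c=B\wedge\bigwedge_S\mathrm{amo}^*(S),\quad \psi_p=B\wedge\bigwedge_S\mathrm{eo}^*(S),\quad \psi'_c=B\wedge\bigwedge_S\mu_{|S|}(S,\mathbf z_S),\quad \psi'_p=B\wedge\bigwedge_S\epsilon_{|S|}(S,\mathbf z_S).$$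 Here each $S$ is listed in an arbitrary fixed order and the vectors $\mathbf z_S$ of auxiliary variables are pairwise disjoint and new. In all four formulas the input variables are $\mathrm{dvar}(\mathbf x)$; the auxiliary variables are $\mathbf v$ in $\psi_c,\psi_p$, and $\mathbf v$ together with all $\mathbf z_S$ in $\psi'_c,\psi'_p$. \textbf{Theorem.} For every smooth DNNF $D$ with a cover by separators as above, the formulas $\psi_c$ and $\psi'_c$ are URC encodings of $f'_D$, and the formulas $\psi_p$ and $\psi'_p$ are PC encodings of $f'_D$. -/

import Mathlib

namespace DNNFEnc

/-! ### CNF formulas, unit resolution, encodings -/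

/-- Literals on the variables `V`. -/
inductive Lit (V : Type*) where
  | pos (x : V) : Lit V
  | neg (x : V) : Lit V

namespace Lit

variable {V U : Type*}

def compl : Lit V → Lit V
  | pos x => neg x
  | neg x => pos x

def var : Lit V → V
  | pos x => x
  | neg x => x

/-- The literal is satisfied by the full assignment `a`. -/
def Holds (a : V → Bool) : Lit V → Prop
  | pos x => a x = true
  | neg x => a x = false

def rename (e : U → V) : Lit U → Lit V
  | pos x => pos (e x)
  | neg x => neg (e x)

end Lit

/-- A clause is a set of literals, understood as their disjunction (all the variable types
used below are finite, so that clauses and formulas are finite). -/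
abbrev Clause (V : Type*) := Set (Lit V)

/-- A CNF formula is a set of clauses, understood as their conjunction. -/
abbrev CNF (V : Type*) := Set (Clause V)

section
variable {V U X Y : Type*}

def Clause.Holds (a : V → Bool) (C : Clause V) : Prop := ∃ l ∈ C, l.Holds a

def CNF.Holds (a : V → Bool) (φ : CNF V) : Prop := ∀ C ∈ φ, Clause.Holds a C

def CNF.rename (e : U → V) (φ : CNF U) : CNF V :=
  (fun C : Clause U => (Lit.rename e '' C : Clause V)) '' φ

/-- The formula `φ ∧ α` for a set of literals `α`. -/
def CNF.assume (φ : CNF V) (α : Set (Lit V)) : CNF V :=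
  φ ∪ {C | ∃ l ∈ α, C = {l}}

/-- `φ.Derives C` means that `C` can be derived from `φ` by unit resolution. -/
inductive CNF.Derives (φ : CNF V) : Clause V → Prop
  | of_mem {C : Clause V} : C ∈ φ → CNF.Derives φ C
  | unit_res {C : Clause V} {l : Lit V} : CNF.Derives φ C → l ∈ C →
      CNF.Derives φ {l.compl} → CNF.Derives φ (C \ {l})

/-- A partial assignment of the variables in `v`: a set of literals on `v` without
a complementary pair. -/
def IsPartialAssignment (v : Set V) (α : Set (Lit V)) : Prop :=
  (∀ l ∈ α, l.var ∈ v) ∧ ∀ l ∈ α, l.compl ∉ α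

/-- Unit refutation completeness on the variables `v`. -/
def CNF.URCOn (φ : CNF V) (v : Set V) : Prop :=
  ∀ α : Set (Lit V), IsPartialAssignment v α →
    (∀ a : V → Bool, ¬ (φ.assume α).Holds a) → (φ.assume α).Derives ∅

/-- Propagation completeness on the variables `v`. -/
def CNF.PCOn (φ : CNF V) (v : Set V) : Prop :=
  ∀ α : Set (Lit V), IsPartialAssignment v α → ∀ l : Lit V, l.var ∈ v →
    (∀ a : V → Bool, (φ.assume α).Holds a → l.Holds a) →
      (φ.assume α).Derives {l} ∨ (φ.assume α).Derives ∅

/-- `φ`, with input variables `X` and auxiliary variables `Y`, is a CNF encoding of `f`. -/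
def IsEncoding (φ : CNF (X ⊕ Y)) (f : (X → Bool) → Prop) : Prop :=
  ∀ a : X → Bool, f a ↔ ∃ b : Y → Bool, φ.Holds (Sum.elim a b)

/-- A URC encoding: an encoding that is URC on all its variables, input and auxiliary. -/
def IsURCEncoding (φ : CNF (X ⊕ Y)) (f : (X → Bool) → Prop) : Prop :=
  IsEncoding φ f ∧ φ.URCOn Set.univ

/-- A PC encoding: an encoding that is PC on all its variables, input and auxiliary. -/
def IsPCEncoding (φ : CNF (X ⊕ Y)) (f : (X → Bool) → Prop) : Prop :=
  IsEncoding φ f ∧ φ.PCOn Set.univ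

/-! ### At-most-one and exactly-one -/

/-- At most one of the variables in `S` is true. -/
def AMO (S : Set V) (a : V → Bool) : Prop :=
  ∀ u ∈ S, ∀ v ∈ S, a u = true → a v = true → u = v

/-- Exactly one of the variables in `S` is true. -/
def EO (S : Set V) (a : V → Bool) : Prop := ∃! u, u ∈ S ∧ a u = true

/-- `C` is an implicate of `f`: a clause without complementary literals implied by `f`. -/
def IsImplicate (f : (V → Bool) → Prop) (C : Clause V) : Prop :=
  (∀ l ∈ C, l.compl ∉ C) ∧ ∀ a, f a → Clause.Holds a C

/-- The set of all prime (inclusion-minimal) implicates of `f`. -/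
def primeImplicates (f : (V → Bool) → Prop) : CNF V :=
  {C | IsImplicate f C ∧ ∀ C' : Clause V, C' ⊂ C → ¬ IsImplicate f C'}

/-- The canonical representation of the at-most-one constraint. -/
def amoRep (S : Set V) : CNF V := primeImplicates (AMO S)

/-- The canonical representation of the exactly-one constraint. -/
def eoRep (S : Set V) : CNF V := amoRep S ∪ {Lit.pos '' S}

/-- The sequential encoding `μ_n(x_1, …, x_n)` of the at-most-one constraint with auxiliary
variables `y_1, …, y_{n-3}` (the empty formula if `n ≤ 1`). -/
def mu : (n : ℕ) → (Fin n → V) → (Fin (n - 3) → V) → CNF V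
  | 0, _, _ => ∅
  | 1, _, _ => ∅
  | 2, x, _ => {{.neg (x 0), .neg (x 1)}}
  | 3, x, _ => {{.neg (x 0), .neg (x 1)}, {.neg (x 0), .neg (x 2)}, {.neg (x 1), .neg (x 2)}}
  | n + 4, x, y =>
    let y' : Fin (n + 1) → V := y
    {{.neg (x 0), .neg (x 1)}, {.neg (x 0), .pos (y' 0)}, {.neg (x 1), .pos (y' 0)}} ∪
      mu (n + 3) (Fin.cons (y' 0) fun i : Fin (n + 2) => x i.succ.succ) fun i => y' i.succ

/-- `ε_3(k, l, m)`, the exactly-one constraint on three literals. -/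
def eps3 (k l m : Lit V) : CNF V :=
  {{k.compl, l.compl}, {k.compl, m.compl}, {l.compl, m.compl}, {k, l, m}}

/-- The splitting encoding `ε_n(l_1, …, l_n)` of the exactly-one constraint on literals, with
auxiliary variables `y_1, …, y_{n-3}`:
`ε_n = ε_3(l_1, l_2, ¬y_1) ∧ ε_3(y_1, l_3, ¬y_2) ∧ … ∧ ε_3(y_{n-3}, l_{n-1}, l_n)` if `n ≥ 4`. -/
def eps : (n : ℕ) → (Fin n → Lit V) → (Fin (n - 3) → V) → CNF V
  | 0, _, _ => {∅}
  | 1, l, _ => {{l 0}}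
  | 2, l, _ => {{(l 0).compl, (l 1).compl}, {l 0, l 1}}
  | 3, l, _ => eps3 (l 0) (l 1) (l 2)
  | n + 4, l, y =>
    let y' : Fin (n + 1) → V := y
    eps3 (l 0) (l 1) (.neg (y' 0)) ∪
      eps (n + 3) (Fin.cons (.pos (y' 0)) fun i : Fin (n + 2) => l i.succ.succ) fun i => y' i.succ

end

/-! ### NNF, DNNF, smoothness -/

inductive Gate where
  | and : Gate
  | or : Gate

/-- The domain variables `⟦x_i = s⟧`, `s ∈ dom x_i`, where `dom x_i` is `κ i`. -/
abbrev DVar (ι : Type*) (κ : ι → Type*) := Σ i : ι, κ i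

/-- A sentence in negation normal form over variables `x_i`, `i : ι`, with domains `κ i`.
Its inner nodes are the elements of `W`, and a leaf is identified with the domain variable that
labels it, so that nodes are elements of `DVar ι κ ⊕ W`. It has no leaf labeled by a constant. -/
structure NNF (ι : Type*) (κ : ι → Type*) (W : Type*) where
  /-- the connective of an inner node -/
  gate : W → Gate
  /-- the inputs (successors) of an inner node -/
  children : W → Set (DVar ι κ ⊕ W)
  /-- the domain variables that occur as leaves -/
  leaves : Set (DVar ι κ)
  root : DVar ι κ ⊕ W
  children_nonempty : ∀ w, (children w).Nonempty
  child_leaf : ∀ w x, Sum.inl x ∈ children w → x ∈ leaves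
  root_leaf : ∀ x, root = Sum.inl x → x ∈ leaves
  /-- there is no directed cycle -/
  acyclic : ∀ v, ¬ Relation.TransGen (fun v u => ∃ w, v = Sum.inr w ∧ u ∈ children w) v v
  /-- every inner node can be reached from the root -/
  reach_inner : ∀ w, Relation.ReflTransGen
    (fun v u => ∃ w, v = Sum.inr w ∧ u ∈ children w) root (Sum.inr w)
  /-- every leaf can be reached from the root -/
  reach_leaf : ∀ x ∈ leaves, Relation.ReflTransGen
    (fun v u => ∃ w, v = Sum.inr w ∧ u ∈ children w) root (Sum.inl x)
  /-- for every `i`, at least one domain variable of `x_i` is a leaf -/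
  exists_leaf : ∀ i, ∃ s, (⟨i, s⟩ : DVar ι κ) ∈ leaves

namespace NNF

variable {ι : Type*} {κ : ι → Type*} {W : Type*} (D : NNF ι κ W)

/-- The directed edges `(v, u)`, from an inner node `v` to one of its inputs `u`. -/
def Edge (v u : DVar ι κ ⊕ W) : Prop := ∃ w, v = Sum.inr w ∧ u ∈ D.children w

/-- `D.Eval a v`: the node `v` evaluates to `1` if the leaves have the values given by `a`. -/
inductive Eval (a : DVar ι κ → Bool) : DVar ι κ ⊕ W → Prop
  | leaf (x : DVar ι κ) : a x = true → Eval a (Sum.inl x)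
  | and (w : W) : D.gate w = Gate.and → (∀ u ∈ D.children w, Eval a u) → Eval a (Sum.inr w)
  | or (w : W) (u : DVar ι κ ⊕ W) : D.gate w = Gate.or → u ∈ D.children w → Eval a u →
      Eval a (Sum.inr w)

/-- The monotone boolean function `f_D` of the domain variables. -/
def fn (a : DVar ι κ → Bool) : Prop := D.Eval a D.root

/-- The function `f'_D`: the conjunction of `f_D` and of the direct encoding constraints. -/
def fn' (a : DVar ι κ → Bool) : Prop := D.fn a ∧ ∀ i, EO {x : DVar ι κ | x.1 = i} a

/-- `var(v)`: the indices `i` such that a leaf on `x_i` can be reached from `v`. -/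
def vars (v : DVar ι κ ⊕ W) : Set ι :=
  {i | ∃ s, (⟨i, s⟩ : DVar ι κ) ∈ D.leaves ∧ Relation.ReflTransGen D.Edge v (Sum.inl ⟨i, s⟩)}

/-- `D` is a DNNF: the inputs of every conjunction have pairwise disjoint sets of variables. -/
def Decomposable : Prop :=
  ∀ w, D.gate w = Gate.and → ∀ u ∈ D.children w, ∀ u' ∈ D.children w, u ≠ u' →
    Disjoint (D.vars u) (D.vars u')

/-- `D` is smooth: every disjunction has the same set of variables as each of its inputs. -/
def Smooth : Prop :=
  ∀ w, D.gate w = Gate.or → ∀ u ∈ D.children w, D.vars u = D.vars (Sum.inr w)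

/-! ### Separators -/

/-- `H_i`, the set of the nodes of `D_i`. -/
def H (i : ι) : Set (DVar ι κ ⊕ W) := {v | i ∈ D.vars v}

/-- `p` is the list of nodes of a directed path in `D_i` from the root to a leaf. -/
def IsRootLeafPath (i : ι) (p : List (DVar ι κ ⊕ W)) : Prop :=
  p.IsChain D.Edge ∧ (∀ v ∈ p, v ∈ D.H i) ∧ p.head? = some D.root ∧
    ∃ x ∈ D.leaves, p.getLast? = some (Sum.inl x)

/-- `S` is a separator in `D_i`. -/
def IsSeparator (i : ι) (S : Finset (DVar ι κ ⊕ W)) : Prop :=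
  (∀ v ∈ S, v ∈ D.H i) ∧ ∀ p, D.IsRootLeafPath i p → ∃! v, v ∈ p ∧ v ∈ S

/-- The collections `𝒮 i` of separators in `D_i` form a cover of `D` by separators. -/
def IsSeparatorCover (𝒮 : ι → Set (Finset (DVar ι κ ⊕ W))) : Prop :=
  ∀ i, (∀ S ∈ 𝒮 i, D.IsSeparator i S) ∧ {v | ∃ S ∈ 𝒮 i, v ∈ S} = D.H i \ {D.root}

/-! ### The encodings -/

/-- `v → v_1 ∨ … ∨ v_k` for each disjunction `v = v_1 ∨ … ∨ v_k`. -/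
def N1 : CNF (DVar ι κ ⊕ W) :=
  {C | ∃ w, D.gate w = Gate.or ∧ C = {Lit.neg (Sum.inr w)} ∪ Lit.pos '' D.children w}

/-- `v → v_j` for each conjunction `v = v_1 ∧ … ∧ v_k` and each `j`. -/
def N2 : CNF (DVar ι κ ⊕ W) :=
  {C | ∃ w, D.gate w = Gate.and ∧ ∃ u ∈ D.children w, C = {Lit.neg (Sum.inr w), Lit.pos u}}

/-- `v → p_1 ∨ … ∨ p_k` for each node `v` with incoming edges, from `p_1, …, p_k`. -/
def N3 : CNF (DVar ι κ ⊕ W) :=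
  {C | ∃ v, (∃ p, D.Edge p v) ∧ C = {Lit.neg v} ∪ Lit.pos '' {p | D.Edge p v}}

/-- `¬l` for each domain variable `l` that is not a leaf. -/
def N4 : CNF (DVar ι κ ⊕ W) := {C | ∃ x, x ∉ D.leaves ∧ C = {Lit.neg (Sum.inl x)}}

/-- The clauses N1–N4 together with the unit clause `ρ`. -/
def base : CNF (DVar ι κ ⊕ W) := D.N1 ∪ D.N2 ∪ D.N3 ∪ D.N4 ∪ {{Lit.pos D.root}}

variable (𝒮 : ι → Set (Finset (DVar ι κ ⊕ W)))

/-- `ψ_c`, with auxiliary variables the inner nodes. -/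
def psiC : CNF (DVar ι κ ⊕ W) := D.base ∪ {C | ∃ i, ∃ S ∈ 𝒮 i, C ∈ amoRep (S : Set (DVar ι κ ⊕ W))}

/-- `ψ_p`, with auxiliary variables the inner nodes. -/
def psiP : CNF (DVar ι κ ⊕ W) := D.base ∪ {C | ∃ i, ∃ S ∈ 𝒮 i, C ∈ eoRep (S : Set (DVar ι κ ⊕ W))}

end NNF

section
variable {ι : Type*} {κ : ι → Type*} {W : Type*}

/-- The separators that occur in the collections `𝒮 i`. -/
abbrev Sep (𝒮 : ι → Set (Finset (DVar ι κ ⊕ W))) := {S : Finset (DVar ι κ ⊕ W) // ∃ i, S ∈ 𝒮 i}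

/-- The variables `z`: for each separator `S`, its own `|S| - 3` auxiliary variables `z_S`
(none if `|S| ≤ 3`). -/
abbrev ZVar (𝒮 : ι → Set (Finset (DVar ι κ ⊕ W))) := Σ S : Sep 𝒮, Fin (S.1.card - 3)

/-- The variable of `ψ'_c` and `ψ'_p` that represents a domain variable or an inner node. -/
def nodeVar (𝒮 : ι → Set (Finset (DVar ι κ ⊕ W))) :
    DVar ι κ ⊕ W → DVar ι κ ⊕ (W ⊕ ZVar 𝒮) :=
  Sum.map id Sum.inl

/-- The variable of `ψ'_c` and `ψ'_p` for the `k`-th auxiliary variable in `z_S`. -/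
def zVar {𝒮 : ι → Set (Finset (DVar ι κ ⊕ W))} (S : Sep 𝒮) (k : Fin (S.1.card - 3)) :
    DVar ι κ ⊕ (W ⊕ ZVar 𝒮) :=
  Sum.inr (Sum.inr ⟨S, k⟩)

/-- `ψ'_c`, with auxiliary variables the inner nodes and `z`, where the elements of each
separator `S` are listed in the order `enum S`. -/
def NNF.psiC' (D : NNF ι κ W) (𝒮 : ι → Set (Finset (DVar ι κ ⊕ W)))
    (enum : ∀ S : Sep 𝒮, Fin S.1.card ≃ {v // v ∈ S.1}) : CNF (DVar ι κ ⊕ (W ⊕ ZVar 𝒮)) :=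
  D.base.rename (nodeVar 𝒮) ∪
    {C | ∃ S : Sep 𝒮, C ∈ mu S.1.card (fun k => nodeVar 𝒮 (enum S k).1) (zVar S)}

/-- `ψ'_p`, with auxiliary variables the inner nodes and `z`, where the elements of each
separator `S` are listed in the order `enum S`. -/
def NNF.psiP' (D : NNF ι κ W) (𝒮 : ι → Set (Finset (DVar ι κ ⊕ W)))
    (enum : ∀ S : Sep 𝒮, Fin S.1.card ≃ {v // v ∈ S.1}) : CNF (DVar ι κ ⊕ (W ⊕ ZVar 𝒮)) :=
  D.base.rename (nodeVar 𝒮) ∪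
    {C | ∃ S : Sep 𝒮, C ∈ eps S.1.card (fun k => Lit.pos (nodeVar 𝒮 (enum S k).1)) (zVar S)}

end

end DNNFEnc

/-!
Let `Λ` be a set of literals without complementary pairs that is closed under unit propagation
(`Closed`). The literals derived by unit resolution from an unrefuted formula form such a set, so
a formula is unit refutation complete if every closed `Λ` holds in some model, and propagation
complete if every literal outside `Λ` is falsified in such a model.

Models come from certificates (`NNF.IsCertificate`): select one input of every disjunction and let
`T` be the set of nodes reachable from the root by selected edges. By decomposability and
smoothness, `T` meets each `D_i` in a single path from the root to a leaf, hence it meets each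
separator in exactly one node (`NNF.isCertificate_of_sel`). By the clauses N1, N2 and the unit clause
for the root, the nodes not falsified by `Λ` contain some certificate `T`; by N3, `T` can be chosen
through any given node that is not falsified (`NNF.exists_certificate_mem`). Conversely, if a node
`v` is true in `Λ`, then propagation in the at-most-one constraint of a separator through `v` falsifies the
rest of that separator, so that `T`, which avoids falsified nodes, contains `v`
(`NNF.IsCertificate.mem_of_pos`). This gives unit refutation completeness. For propagation
completeness, if `v` is not true in `Λ`, then the exactly-one constraint of a separator through `v`
leaves another node `u` of it unfalsified, and a certificate through `u` does not contain `v`.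

The auxiliary variables are treated separately for each separator. If `x_k` is the true variable of
the constraint, the auxiliary variables of both `mu` and `eps` have to be the disjunctions of the
prefixes of `x_0, x_1, …` (`prefixVal`). `AmoGadget` states that this assignment is compatible with
`Λ` unless `Λ` falsifies `x_k`; `EoGadget` adds that every literal of the constraint outside `Λ` is
falsified by one of these assignments with `x_k` not falsified by `Λ`. As different separators share
no auxiliary variables, these assignments can be glued to any certificate.
-/

namespace DNNFEnc

/-! ### Sets of literals closed under unit propagation -/

section
variable {V U I J : Type*}

/-- `Closed φ Λ`: the set of literals `Λ` contains no complementary pair and is closed under unit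
propagation in `φ`, without falsifying a clause of `φ`. (A nonempty clause falsified by `Λ` would
put a complementary pair into `Λ`, so that only the empty clause has to be excluded.) -/
structure Closed (φ : CNF V) (Λ : Set (Lit V)) : Prop where
  compl_notMem : ∀ l ∈ Λ, l.compl ∉ Λ
  mem_of_unit : ∀ C ∈ φ, ∀ l ∈ C, (∀ m ∈ C, m ≠ l → m.compl ∈ Λ) → l ∈ Λ
  empty_notMem : ∅ ∉ φ

theorem Lit.holds_compl (a : V → Bool) (l : Lit V) : l.compl.Holds a ↔ ¬ l.Holds a := by
  cases l <;> simp [Lit.compl, Lit.Holds]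

instance [Finite V] : Finite (Lit V) :=
  Finite.of_surjective (fun p : V ⊕ V => Sum.elim Lit.pos Lit.neg p) (by
    rintro (x | x)
    · exact ⟨Sum.inl x, rfl⟩
    · exact ⟨Sum.inr x, rfl⟩)

theorem Closed.mono {φ φ' : CNF V} {Λ : Set (Lit V)} (h : Closed φ Λ) (hs : φ' ⊆ φ) :
    Closed φ' Λ :=
  ⟨h.compl_notMem, fun C hC => h.mem_of_unit C (hs hC), fun hC => h.empty_notMem (hs hC)⟩

theorem Closed.rename {φ : CNF U} {e : U → V} {Λ : Set (Lit V)} (h : Closed (φ.rename e) Λ) :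
    Closed φ {l | l.rename e ∈ Λ} := by
  have hc : ∀ l : Lit U, (l.rename e).compl = l.compl.rename e := by rintro (x | x) <;> rfl
  refine ⟨fun l hl hl' => h.compl_notMem _ hl (hc l ▸ hl'), fun C hC l hl hm => ?_,
    fun h0 => h.empty_notMem ⟨∅, h0, Set.image_empty _⟩⟩
  refine h.mem_of_unit _ ⟨C, hC, rfl⟩ _ ⟨l, hl, rfl⟩ ?_
  rintro _ ⟨m, hmC, rfl⟩ hne
  rw [hc]
  exact hm m hmC fun h => hne (h ▸ rfl)

theorem holds_rename {φ : CNF U} {e : U → V} {a : V → Bool} (h : φ.Holds (a ∘ e)) :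
    (φ.rename e).Holds a := by
  rintro _ ⟨C, hC, rfl⟩
  obtain ⟨l, hl, ha⟩ := h C hC
  exact ⟨l.rename e, ⟨l, hl, rfl⟩, by cases l <;> exact ha⟩

/-- The literals that hold in a model form a closed set. -/
theorem closed_of_holds {φ : CNF V} {a : V → Bool} (h : φ.Holds a) :
    Closed φ {l | l.Holds a} := by
  refine ⟨fun l hl hl' => (l.holds_compl a).1 hl' hl, fun C hC l hl hm => ?_, fun h0 => ?_⟩
  · obtain ⟨m, hmC, hma⟩ := h C hC
    by_cases hml : m = l
    · exact hml ▸ hma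
    · exact absurd hma ((m.holds_compl a).1 (hm m hmC hml))
  · obtain ⟨m, hm, -⟩ := h ∅ h0
    exact hm

theorem Derives.diff {φ : CNF V} {C : Clause V} (hC : φ.Derives C) {F : Set (Lit V)}
    (hF : F.Finite) (h : ∀ m ∈ F, φ.Derives {m.compl}) : φ.Derives (C \ F) := by
  induction F, hF using Set.Finite.induction_on with
  | empty => simpa using hC
  | @insert m F _ _ ih =>
    have ih := ih fun k hk => h k (Set.mem_insert_of_mem _ hk)
    have he : C \ insert m F = (C \ F) \ {m} := by
      ext k; simp only [Set.mem_sdiff, Set.mem_insert_iff, Set.mem_singleton_iff]; tauto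
    by_cases hm : m ∈ C \ F
    · rw [he]
      exact ih.unit_res hm (h m (Set.mem_insert _ _))
    · rwa [he, Set.sdiff_singleton_eq_self hm]

/-- If unit resolution does not refute `φ`, then the literals it derives form a closed set. -/
theorem closed_of_not_derives [Finite V] {φ : CNF V} (h : ¬ φ.Derives ∅) :
    Closed φ {l | φ.Derives {l}} := by
  refine ⟨fun l hl hl' => h ?_, fun C hC l hl hm => ?_, fun h0 => h (.of_mem h0)⟩
  · simpa using CNF.Derives.unit_res hl rfl hl'
  · have := Derives.diff (.of_mem hC) (Set.toFinite (C \ {l})) fun m hm' => hm m hm'.1 hm'.2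
    rwa [Set.sdiff_sdiff_cancel_left (Set.singleton_subset_iff.2 hl)] at this

theorem urcOn_univ_of_closed [Finite V] {φ : CNF V}
    (h : ∀ Λ, Closed φ Λ → ∃ a, φ.Holds a ∧ ∀ l ∈ Λ, l.Holds a) : φ.URCOn Set.univ := by
  intro α _ hα
  by_contra hd
  obtain ⟨a, ha, hl⟩ := h _ ((closed_of_not_derives hd).mono Set.subset_union_left)
  refine hα a ?_
  rintro C (hC | ⟨l, hlα, rfl⟩)
  · exact ha C hC
  · exact ⟨l, rfl, hl l (.of_mem (Or.inr ⟨l, hlα, rfl⟩))⟩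

theorem pcOn_univ_of_closed [Finite V] {φ : CNF V}
    (h : ∀ Λ, Closed φ Λ → ∀ k ∉ Λ, ∃ a, φ.Holds a ∧ (∀ l ∈ Λ, l.Holds a) ∧ ¬ k.Holds a) :
    φ.PCOn Set.univ := by
  intro α _ k _ hα
  by_contra! hd
  obtain ⟨a, ha, hl, hk⟩ :=
    h _ ((closed_of_not_derives hd.2).mono Set.subset_union_left) k hd.1
  refine hk (hα a ?_)
  rintro C (hC | ⟨l, hlα, rfl⟩)
  · exact ha C hC
  · exact ⟨l, rfl, hl l (.of_mem (Or.inr ⟨l, hlα, rfl⟩))⟩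

theorem Closed.unit {φ : CNF V} {Λ : Set (Lit V)} (h : Closed φ Λ) {l : Lit V}
    (hC : ({l} : Clause V) ∈ φ) : l ∈ Λ :=
  h.mem_of_unit _ hC l rfl fun _ hm hne => absurd hm hne

theorem Closed.pair {φ : CNF V} {Λ : Set (Lit V)} (h : Closed φ Λ) {l m : Lit V}
    (hC : ({l, m} : Clause V) ∈ φ) (hm : m.compl ∈ Λ) : l ∈ Λ := by
  refine h.mem_of_unit _ hC l (by simp) ?_
  rintro k (rfl | rfl) hne
  · exact absurd rfl hne
  · exact hm

theorem Closed.pair' {φ : CNF V} {Λ : Set (Lit V)} (h : Closed φ Λ) {l m : Lit V}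
    (hC : ({l, m} : Clause V) ∈ φ) (hl : l.compl ∈ Λ) : m ∈ Λ :=
  h.pair (by rwa [Set.pair_comm]) hl

theorem Closed.triple {φ : CNF V} {Λ : Set (Lit V)} (h : Closed φ Λ) {l m k : Lit V}
    (hC : ({l, m, k} : Clause V) ∈ φ) (hm : m.compl ∈ Λ) (hk : k.compl ∈ Λ) : l ∈ Λ := by
  refine h.mem_of_unit _ hC l (by simp) ?_
  rintro j (rfl | rfl | rfl) hne
  · exact absurd rfl hne
  · exact hm
  · exact hk

theorem Closed.triple' {φ : CNF V} {Λ : Set (Lit V)} (h : Closed φ Λ) {l m k : Lit V}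
    (hC : ({l, m, k} : Clause V) ∈ φ) (hl : l.compl ∈ Λ) (hk : k.compl ∈ Λ) : m ∈ Λ :=
  h.triple (by rwa [Set.insert_comm]) hl hk

theorem Closed.triple'' {φ : CNF V} {Λ : Set (Lit V)} (h : Closed φ Λ) {l m k : Lit V}
    (hC : ({l, m, k} : Clause V) ∈ φ) (hl : l.compl ∈ Λ) (hm : m.compl ∈ Λ) : k ∈ Λ :=
  h.triple' (by rwa [Set.pair_comm]) hl hm

/-! ### At-most-one and exactly-one constraints -/

/-- `φ` represents an at-most-one constraint on the variables `x`, with auxiliary variables `y`, in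
the sense needed for unit refutation completeness: if exactly `x k` is true, then `y := b k`
satisfies `φ`, and this assignment is consistent with every closed set of literals that does not
falsify `x k`. -/
structure AmoGadget (φ : CNF V) (x : I → V) (y : J → V) (b : I → J → Bool) : Prop where
  sat : ∀ k a, (∀ j, a (x j) = true ↔ j = k) → (∀ i, a (y i) = b k i) → φ.Holds a
  eq_of_pos : ∀ Λ, Closed φ Λ → ∀ k, .neg (x k) ∉ Λ → ∀ j, .pos (x j) ∈ Λ → j = k
  pos_aux : ∀ Λ, Closed φ Λ → ∀ k, .neg (x k) ∉ Λ → ∀ i, .pos (y i) ∈ Λ → b k i = true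
  neg_aux : ∀ Λ, Closed φ Λ → ∀ k, .neg (x k) ∉ Λ → ∀ i, .neg (y i) ∈ Λ → b k i = false

/-- `φ` represents an exactly-one constraint on the variables `x`, with auxiliary variables `y`, in
the sense needed for propagation completeness: a literal that is not in a closed set of literals
is falsified by one of the assignments `x k = 1`, `y = b k` for which `x k` is not falsified. -/
structure EoGadget (φ : CNF V) (x : I → V) (y : J → V) (b : I → J → Bool) : Prop
    extends AmoGadget φ x y b where
  exists_ne : ∀ Λ, Closed φ Λ → ∀ j, .pos (x j) ∉ Λ → ∃ k, k ≠ j ∧ .neg (x k) ∉ Λ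
  exists_false : ∀ Λ, Closed φ Λ → ∀ i, .pos (y i) ∉ Λ → ∃ k, .neg (x k) ∉ Λ ∧ b k i = false
  exists_true : ∀ Λ, Closed φ Λ → ∀ i, .neg (y i) ∉ Λ → ∃ k, .neg (x k) ∉ Λ ∧ b k i = true

theorem AmoGadget.reindex {I' : Type*} {φ : CNF V} {x : I → V} {y : J → V} {b : I → J → Bool}
    (h : AmoGadget φ x y b) (e : I' ≃ I) : AmoGadget φ (x ∘ e) y (b ∘ e) where
  sat k a hx hy := h.sat (e k) a (fun j => by simpa [e.symm_apply_eq] using hx (e.symm j)) hy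
  eq_of_pos Λ hΛ k hk j hj := e.injective (h.eq_of_pos Λ hΛ _ hk _ hj)
  pos_aux Λ hΛ k hk := h.pos_aux Λ hΛ _ hk
  neg_aux Λ hΛ k hk := h.neg_aux Λ hΛ _ hk

theorem EoGadget.reindex {I' : Type*} {φ : CNF V} {x : I → V} {y : J → V} {b : I → J → Bool}
    (h : EoGadget φ x y b) (e : I' ≃ I) : EoGadget φ (x ∘ e) y (b ∘ e) where
  toAmoGadget := h.toAmoGadget.reindex e
  exists_ne Λ hΛ j hj := by
    obtain ⟨k, hkj, hk⟩ := h.exists_ne Λ hΛ _ hj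
    exact ⟨e.symm k, fun hh => hkj (e.symm_apply_eq.1 hh), by simpa using hk⟩
  exists_false Λ hΛ i hi := by
    obtain ⟨k, hk, hb⟩ := h.exists_false Λ hΛ i hi
    exact ⟨e.symm k, by simpa using hk, by simpa using hb⟩
  exists_true Λ hΛ i hi := by
    obtain ⟨k, hk, hb⟩ := h.exists_true Λ hΛ i hi
    exact ⟨e.symm k, by simpa using hk, by simpa using hb⟩

theorem pair_mem_amoRep {S : Set V} {u v : V} (hu : u ∈ S) (hv : v ∈ S) (huv : u ≠ v) :
    ({.neg u, .neg v} : Clause V) ∈ amoRep S := by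
  classical
  refine ⟨⟨?_, fun a ha => ?_⟩, fun C hC hCi => ?_⟩
  · rintro l (rfl | rfl) <;> simp [Lit.compl]
  · by_cases hau : a u = true
    · refine ⟨.neg v, by simp, ?_⟩
      by_contra hav
      exact huv (ha u hu v hv hau (by simpa [Lit.Holds] using hav))
    · exact ⟨.neg u, by simp, by simpa [Lit.Holds] using hau⟩
  · -- A proper subclause omits `¬ w` for some `w ∈ {u, v}`: it is falsified where `w` is false and
    -- the other variable is the only true one.
    have key : ∀ w w' : V, w' ∈ S → C ⊆ {.neg w, .neg w'} → Lit.neg w ∉ C → False := by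
      intro w w' hw' hsub hw
      obtain ⟨l, hl, hla⟩ := hCi.2 (fun z => decide (z = w')) (by
        intro p _ q _ hp hq
        exact (of_decide_eq_true hp).trans (of_decide_eq_true hq).symm)
      rcases hsub hl with rfl | rfl
      · exact hw hl
      · simp [Lit.Holds] at hla
    by_cases h1 : Lit.neg u ∈ C
    · refine key v u hu (by rw [Set.pair_comm]; exact hC.1) fun h2 => hC.2 ?_
      rintro l (rfl | rfl) <;> assumption
    · exact key u v hv hC.1 h1

theorem amoGadget_amoRep (S : Set V) (y : Fin 0 → V) :
    AmoGadget (amoRep S) (fun v : S => v.1) y (fun _ _ => false) where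
  sat k a hx _ C hC := hC.1.2 a fun u hu v hv hau hav => by
    have h1 := (hx ⟨u, hu⟩).1 hau
    have h2 := (hx ⟨v, hv⟩).1 hav
    exact congrArg Subtype.val (h1.trans h2.symm)
  eq_of_pos Λ hΛ k hk j hj := by
    by_contra hne
    exact hk (hΛ.pair (pair_mem_amoRep k.2 j.2 fun h => hne (Subtype.ext h.symm)) hj)
  pos_aux _ _ _ _ i := i.elim0
  neg_aux _ _ _ _ i := i.elim0

theorem eoGadget_eoRep (S : Set V) (y : Fin 0 → V) :
    EoGadget (eoRep S) (fun v : S => v.1) y (fun _ _ => false) where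
  sat k a hx hy := by
    rintro C (hC | rfl)
    · exact (amoGadget_amoRep S y).sat k a hx hy C hC
    · exact ⟨.pos k, ⟨k, k.2, rfl⟩, (hx k).2 rfl⟩
  eq_of_pos Λ hΛ := (amoGadget_amoRep S y).eq_of_pos Λ (hΛ.mono Set.subset_union_left)
  pos_aux _ _ _ _ i := i.elim0
  neg_aux _ _ _ _ i := i.elim0
  exists_ne Λ hΛ j hj := by
    by_contra! h
    refine hj (hΛ.mem_of_unit _ (Or.inr rfl) _ ⟨j, j.2, rfl⟩ ?_)
    rintro _ ⟨v, hv, rfl⟩ hne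
    exact h ⟨v, hv⟩ fun hh => hne (by rw [← hh])
  exists_false _ _ i := i.elim0
  exists_true _ _ i := i.elim0

/-- The value of the `i`-th auxiliary variable of `mu` and of `eps` if the `k`-th constrained
variable is the only true one: the auxiliary variable is the disjunction of the constrained
variables with the indices `0, …, i + 1`. -/
def prefixVal (n : ℕ) (k : Fin n) (i : Fin (n - 3)) : Bool := decide (k.val ≤ i.val + 1)

theorem eps_add_four (n : ℕ) (x : Fin (n + 4) → V) (y : Fin (n + 1) → V) :
    eps (n + 4) (fun k => .pos (x k)) y = eps3 (.pos (x 0)) (.pos (x 1)) (.neg (y 0)) ∪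
      eps (n + 3) (fun k => .pos ((Fin.cons (y 0) fun i : Fin (n + 2) => x i.succ.succ :
        Fin (n + 3) → V) k)) fun i : Fin n => y i.succ := by
  have : (Fin.cons (.pos (y 0)) fun i : Fin (n + 2) => .pos (x i.succ.succ) :
      Fin (n + 3) → Lit V) = fun k => .pos ((Fin.cons (y 0) fun i : Fin (n + 2) =>
        x i.succ.succ : Fin (n + 3) → V) k) := by
    funext j
    exact Fin.cases rfl (fun _ => rfl) j
  rw [← this]
  rfl

theorem mu_subset_eps (n : ℕ) (x : Fin n → V) (y : Fin (n - 3) → V) :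
    mu n x y ⊆ eps n (fun k => .pos (x k)) y := by
  induction n using Nat.strong_induction_on with
  | _ n ih =>
  match n, x, y, ih with
  | 0, _, _, _ => exact Set.empty_subset _
  | 1, _, _, _ => exact Set.empty_subset _
  | 2, x, y, _ => simp [mu, eps, Lit.compl]
  | 3, x, y, _ =>
    intro C
    simp only [mu, eps, eps3, Lit.compl, Set.mem_insert_iff, Set.mem_singleton_iff]
    tauto
  | n + 4, x, y, ih =>
    rw [eps_add_four]
    refine Set.union_subset_union ?_ (ih (n + 3) (by omega) _ _)
    intro C
    simp only [eps3, Lit.compl, Set.mem_insert_iff, Set.mem_singleton_iff]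
    tauto

/-- The case distinction that follows the recursion of `mu` and `eps`, which replaces the variables
with the indices `0` and `1` by one new variable. -/
theorem Fin.eq_zero_or_one_or_succ_succ {n : ℕ} (k : Fin (n + 4)) :
    (k = 0 ∨ k = 1) ∨ ∃ j : Fin (n + 2), k = j.succ.succ := by
  refine Fin.cases (Or.inl (Or.inl rfl)) (fun k => ?_) k
  exact Fin.cases (Or.inl (Or.inr rfl)) (fun j => Or.inr ⟨j, rfl⟩) k

theorem eps_sat (n : ℕ) (x : Fin n → V) (y : Fin (n - 3) → V) (k : Fin n) (a : V → Bool)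
    (hx : ∀ j, a (x j) = true ↔ j = k) (hy : ∀ i, a (y i) = prefixVal n k i) :
    CNF.Holds a (eps n (fun k => .pos (x k)) y) := by
  have hx' : ∀ j, a (x j) = decide (j = k) := fun j => by
    rw [Bool.eq_iff_iff, hx, decide_eq_true_iff]
  induction n using Nat.strong_induction_on with
  | _ n ih =>
  match n, x, y, k, hx, hy, ih with
  | 0, _, _, k, _, _, _ => exact k.elim0
  | 1, x, y, k, hx, hy, _ =>
    rintro _ rfl
    exact ⟨_, rfl, (hx 0).2 (Subsingleton.elim _ _)⟩
  | 2, x, y, k, hx, hy, _ =>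
    fin_cases k <;>
      simp [CNF.Holds, Clause.Holds, eps, Lit.compl, Lit.Holds, hx']
  | 3, x, y, k, hx, hy, _ =>
    fin_cases k <;>
      simp [CNF.Holds, Clause.Holds, eps, eps3, Lit.compl, Lit.Holds, hx']
  | n + 4, x, y, k, hx, hy, ih =>
    rw [eps_add_four]
    have h0 := hx' 0
    have h1 := hx' 1
    rcases Fin.eq_zero_or_one_or_succ_succ k with hk | ⟨j, rfl⟩
    · have hk1 : k.val ≤ 1 := by rcases hk with rfl | rfl <;> simp
      have hy0 : a (y (0 : Fin (n + 1))) = true := by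
        rw [hy (0 : Fin (n + 1))]; simpa [prefixVal] using hk1
      have hs : ∀ j : Fin (n + 2), a (x j.succ.succ) = false := fun j => by
        rw [hx', decide_eq_false_iff_not]
        rintro rfl
        simp at hk1
      rintro C (hC | hC)
      · revert C
        rcases hk with rfl | rfl <;>
          simp [Clause.Holds, eps3, Lit.compl, Lit.Holds, h0, h1, hy0]
      · refine ih (n + 3) (by omega) _ _ 0 (fun j => ?_) (fun i => ?_) (fun j => ?_) C hC
        · refine Fin.cases (by simpa using hy0) (fun j => ?_) j
          simp [hs]
        · exact (hy i.succ).trans (by simp [prefixVal]; omega)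
        · refine Fin.cases (by simpa using hy0) (fun j => ?_) j
          simp [hs]
    · have hy0 : a (y (0 : Fin (n + 1))) = false := by
        rw [hy (0 : Fin (n + 1))]; simp [prefixVal]
      have h0 : a (x 0) = false := by
        rw [h0, decide_eq_false_iff_not]; exact (Fin.succ_ne_zero _).symm
      have h1 : a (x 1) = false := by
        rw [h1, decide_eq_false_iff_not, ← Fin.succ_zero_eq_one, Fin.succ_inj]
        exact (Fin.succ_ne_zero _).symm
      have hs : ∀ i : Fin (n + 2), a (x i.succ.succ) = decide (i = j) := fun i => by
        simp [hx']
      rintro C (hC | hC)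
      · revert C
        simp [Clause.Holds, eps3, Lit.compl, Lit.Holds, h0, h1, hy0]
      · refine ih (n + 3) (by omega) _ _ j.succ (fun i => ?_) (fun i => ?_) (fun i => ?_) C hC
        · refine Fin.cases ?_ (fun i => ?_) i
          · simpa [hy0] using (Fin.succ_ne_zero j).symm
          · simp [hs]
        · exact (hy i.succ).trans (by simp [prefixVal])
        · refine Fin.cases ?_ (fun i => ?_) i
          · simpa [hy0] using (Fin.succ_ne_zero j).symm
          · simp [hs]

theorem amoGadget_mu (n : ℕ) (x : Fin n → V) (y : Fin (n - 3) → V) :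
    AmoGadget (mu n x y) x y (prefixVal n) := by
  suffices h : ∀ Λ, Closed (mu n x y) Λ → ∀ k, .neg (x k) ∉ Λ →
      (∀ j, .pos (x j) ∈ Λ → j = k) ∧ ∀ i, (.pos (y i) ∈ Λ → prefixVal n k i = true) ∧
        (.neg (y i) ∈ Λ → prefixVal n k i = false) from
    ⟨fun k a hx hy C hC => eps_sat n x y k a hx hy C (mu_subset_eps n x y hC),
      fun Λ hΛ k hk => (h Λ hΛ k hk).1, fun Λ hΛ k hk i => ((h Λ hΛ k hk).2 i).1,
      fun Λ hΛ k hk i => ((h Λ hΛ k hk).2 i).2⟩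
  intro Λ hΛ k hk
  induction n using Nat.strong_induction_on with
  | _ n ih =>
  match n, x, y, k, hΛ, hk, ih with
  | 0, _, _, k, _, _, _ => exact k.elim0
  | 1, x, y, k, hΛ, hk, _ => exact ⟨fun _ _ => Subsingleton.elim _ _, fun i => i.elim0⟩
  | 2, x, y, k, hΛ, hk, _ =>
    refine ⟨fun j hj => ?_, fun i => i.elim0⟩
    by_contra hjk
    have h01 : ({.neg (x 0), .neg (x 1)} : Clause V) ∈ mu 2 x y := rfl
    fin_cases k <;> fin_cases j <;> first
      | exact hjk rfl
      | exact hk (hΛ.pair h01 hj)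
      | exact hk (hΛ.pair' h01 hj)
  | 3, x, y, k, hΛ, hk, _ =>
    refine ⟨fun j hj => ?_, fun i => i.elim0⟩
    by_contra hjk
    have h01 : ({.neg (x 0), .neg (x 1)} : Clause V) ∈ mu 3 x y := Or.inl rfl
    have h02 : ({.neg (x 0), .neg (x 2)} : Clause V) ∈ mu 3 x y := Or.inr (Or.inl rfl)
    have h12 : ({.neg (x 1), .neg (x 2)} : Clause V) ∈ mu 3 x y := Or.inr (Or.inr rfl)
    fin_cases k <;> fin_cases j <;> first
      | exact hjk rfl
      | exact hk (hΛ.pair h01 hj)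
      | exact hk (hΛ.pair' h01 hj)
      | exact hk (hΛ.pair h02 hj)
      | exact hk (hΛ.pair' h02 hj)
      | exact hk (hΛ.pair h12 hj)
      | exact hk (hΛ.pair' h12 hj)
  | n + 4, x, y, k, hΛ, hk, ih =>
    have h01 : ({.neg (x 0), .neg (x 1)} : Clause V) ∈ mu (n + 4) x y := Or.inl (Or.inl rfl)
    have h0y : ({.neg (x 0), .pos (y (0 : Fin (n + 1)))} : Clause V) ∈ mu (n + 4) x y :=
      Or.inl (Or.inr (Or.inl rfl))
    have h1y : ({.neg (x 1), .pos (y (0 : Fin (n + 1)))} : Clause V) ∈ mu (n + 4) x y :=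
      Or.inl (Or.inr (Or.inr rfl))
    have ih := ih (n + 3) (by omega) _ _ (hΛ.mono Set.subset_union_right)
    rcases Fin.eq_zero_or_one_or_succ_succ k with hk' | ⟨m, rfl⟩
    · have hk1 : k.val ≤ 1 := by rcases hk' with rfl | rfl <;> simp
      have hy0 : .neg (y (0 : Fin (n + 1))) ∉ Λ := fun h => by
        rcases hk' with rfl | rfl
        · exact hk (hΛ.pair h0y h)
        · exact hk (hΛ.pair h1y h)
      obtain ⟨ih1, ih2⟩ := ih 0 hy0
      refine ⟨fun j hj => ?_, fun i => ?_⟩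
      · rcases Fin.eq_zero_or_one_or_succ_succ j with hj' | ⟨j, rfl⟩
        · by_contra hjk
          rcases hk' with rfl | rfl <;> rcases hj' with rfl | rfl
          · exact hjk rfl
          · exact hk (hΛ.pair h01 hj)
          · exact hk (hΛ.pair' h01 hj)
          · exact hjk rfl
        · exact absurd (ih1 j.succ hj) (Fin.succ_ne_zero _)
      · have hb : prefixVal (n + 4) k i = true := by simp [prefixVal]; omega
        refine ⟨fun _ => hb, fun hi => ?_⟩
        refine Fin.cases (motive := fun i : Fin (n + 1) => .neg (y i) ∈ Λ →
          prefixVal (n + 4) k i = false) (fun h => absurd h hy0) (fun i hi => ?_) i hi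
        exact absurd ((ih2 i).2 hi) (by simp [prefixVal])
    · obtain ⟨ih1, ih2⟩ := ih m.succ hk
      have hy0 : .pos (y (0 : Fin (n + 1))) ∉ Λ := fun h =>
        (Fin.succ_ne_zero m) (ih1 0 h).symm
      refine ⟨fun j hj => ?_, fun i => ?_⟩
      · rcases Fin.eq_zero_or_one_or_succ_succ j with (rfl | rfl) | ⟨j, rfl⟩
        · exact absurd (hΛ.pair' h0y hj) hy0
        · exact absurd (hΛ.pair' h1y hj) hy0
        · exact congrArg Fin.succ (ih1 j.succ hj)
      · refine Fin.cases (motive := fun i : Fin (n + 1) =>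
          (.pos (y i) ∈ Λ → prefixVal (n + 4) m.succ.succ i = true) ∧
          (.neg (y i) ∈ Λ → prefixVal (n + 4) m.succ.succ i = false)) ?_ (fun i => ?_) i
        · exact ⟨fun h => absurd h hy0, fun _ => by simp [prefixVal]⟩
        · have hb : prefixVal (n + 4) m.succ.succ i.succ = prefixVal (n + 3) m.succ i := by
            simp [prefixVal]
          rw [hb]
          exact ih2 i

theorem eoGadget_eps (n : ℕ) (x : Fin n → V) (y : Fin (n - 3) → V) :
    EoGadget (eps n (fun k => .pos (x k)) y) x y (prefixVal n) := by
  suffices h : ∀ Λ, Closed (eps n (fun k => .pos (x k)) y) Λ →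
      (∀ j, .pos (x j) ∉ Λ → ∃ k, k ≠ j ∧ .neg (x k) ∉ Λ) ∧
      (∀ i, (.pos (y i) ∉ Λ → ∃ k, .neg (x k) ∉ Λ ∧ prefixVal n k i = false) ∧
        (.neg (y i) ∉ Λ → ∃ k, .neg (x k) ∉ Λ ∧ prefixVal n k i = true)) from
    ⟨⟨eps_sat n x y,
      fun Λ hΛ => (amoGadget_mu n x y).eq_of_pos Λ (hΛ.mono (mu_subset_eps n x y)),
      fun Λ hΛ => (amoGadget_mu n x y).pos_aux Λ (hΛ.mono (mu_subset_eps n x y)),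
      fun Λ hΛ => (amoGadget_mu n x y).neg_aux Λ (hΛ.mono (mu_subset_eps n x y))⟩,
      fun Λ hΛ => (h Λ hΛ).1, fun Λ hΛ i => ((h Λ hΛ).2 i).1, fun Λ hΛ i => ((h Λ hΛ).2 i).2⟩
  intro Λ hΛ
  induction n using Nat.strong_induction_on with
  | _ n ih =>
  match n, x, y, hΛ, ih with
  | 0, _, _, _, _ => exact ⟨fun j => j.elim0, fun i => i.elim0⟩
  | 1, x, y, hΛ, _ =>
    refine ⟨fun j hj => absurd (hΛ.unit ?_) hj, fun i => i.elim0⟩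
    rw [Subsingleton.elim j 0]
    rfl
  | 2, x, y, hΛ, _ =>
    refine ⟨fun j hj => ?_, fun i => i.elim0⟩
    have h : ({.pos (x 0), .pos (x 1)} : Clause V) ∈ eps 2 (fun k => .pos (x k)) y := Or.inr rfl
    by_contra! hk
    fin_cases j
    · exact hj (hΛ.pair h (hk 1 (by decide)))
    · exact hj (hΛ.pair' h (hk 0 (by decide)))
  | 3, x, y, hΛ, _ =>
    refine ⟨fun j hj => ?_, fun i => i.elim0⟩
    have h : ({.pos (x 0), .pos (x 1), .pos (x 2)} : Clause V) ∈
      eps 3 (fun k => .pos (x k)) y := Or.inr (Or.inr (Or.inr rfl))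
    by_contra! hk
    fin_cases j
    · exact hj (hΛ.triple h (hk 1 (by decide)) (hk 2 (by decide)))
    · exact hj (hΛ.triple' h (hk 0 (by decide)) (hk 2 (by decide)))
    · exact hj (hΛ.triple'' h (hk 0 (by decide)) (hk 1 (by decide)))
  | n + 4, x, y, hΛ, ih =>
    rw [eps_add_four] at hΛ
    have h3 := hΛ.mono Set.subset_union_left
    have hc : ({.pos (x 0), .pos (x 1), .neg (y (0 : Fin (n + 1)))} : Clause V) ∈
      eps3 (.pos (x 0)) (.pos (x 1)) (.neg (y (0 : Fin (n + 1)))) := Or.inr (Or.inr (Or.inr rfl))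
    obtain ⟨ih1, ih2⟩ := ih (n + 3) (by omega) _ _ (hΛ.mono Set.subset_union_right)
    have hy0 : .neg (y (0 : Fin (n + 1))) ∉ Λ →
        ∃ k : Fin (n + 4), k.val ≤ 1 ∧ .neg (x k) ∉ Λ := by
      intro h
      by_contra! hk
      exact h (h3.triple'' hc (hk 0 (by simp)) (hk 1 (by simp)))
    have hpos : ∀ i : Fin (n + 1), .pos (y i) ∉ Λ →
        ∃ k, .neg (x k) ∉ Λ ∧ prefixVal (n + 4) k i = false := by
      refine Fin.cases (fun h => ?_) (fun i h => ?_)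
      · obtain ⟨k, hk0, hk⟩ := ih1 0 h
        obtain ⟨k, rfl⟩ := Fin.exists_succ_eq.2 hk0
        exact ⟨k.succ.succ, hk, by simp [prefixVal]⟩
      · obtain ⟨k, hk, hb⟩ := (ih2 i).1 h
        rcases Fin.eq_zero_or_eq_succ k with rfl | ⟨k, rfl⟩
        · simp [prefixVal] at hb
        · exact ⟨k.succ.succ, hk, by simpa [prefixVal] using hb⟩
    refine ⟨fun j hj => ?_, fun i => ⟨hpos i, ?_⟩⟩
    · rcases Fin.eq_zero_or_one_or_succ_succ j with hj' | ⟨j, rfl⟩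
      · by_cases hy : .pos (y (0 : Fin (n + 1))) ∈ Λ
        · rcases hj' with rfl | rfl
          · exact ⟨1, by simp, fun h => hj (h3.triple hc h hy)⟩
          · exact ⟨0, by simp, fun h => hj (h3.triple' hc h hy)⟩
        · obtain ⟨k, hk, hb⟩ := hpos 0 hy
          refine ⟨k, ?_, hk⟩
          rintro rfl
          rcases hj' with rfl | rfl <;> simp [prefixVal] at hb
      · obtain ⟨k, hkj, hk⟩ := ih1 j.succ hj
        rcases Fin.eq_zero_or_eq_succ k with rfl | ⟨k, rfl⟩
        · obtain ⟨k, hk1, hk⟩ := hy0 hk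
          refine ⟨k, ?_, hk⟩
          rintro rfl
          simp at hk1
        · exact ⟨k.succ.succ, fun h => hkj (Fin.succ_injective _ h), hk⟩
    · refine Fin.cases (motive := fun i : Fin (n + 1) => .neg (y i) ∉ Λ →
          ∃ k, .neg (x k) ∉ Λ ∧ prefixVal (n + 4) k i = true) (fun h => ?_) (fun i h => ?_) i
      · obtain ⟨k, hk1, hk⟩ := hy0 h
        exact ⟨k, hk, by simpa [prefixVal] using hk1⟩
      · obtain ⟨k, hk, hb⟩ := (ih2 i).2 h
        rcases Fin.eq_zero_or_eq_succ k with rfl | ⟨k, rfl⟩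
        · obtain ⟨k, hk1, hk⟩ := hy0 hk
          exact ⟨k, hk, by simp [prefixVal]; omega⟩
        · exact ⟨k.succ.succ, hk, by simpa [prefixVal] using hb⟩

end

/-! ### Certificates: minimal satisfied subgraphs of a smooth DNNF -/

namespace NNF

variable {ι : Type*} {κ : ι → Type*} {W : Type*} (D : NNF ι κ W)

/-- A certificate of `D`: a set of nodes that contains the root, all inputs of its conjunctions and
an input of each of its disjunctions, in which every node except the root has a predecessor, and
which has exactly one node in common with every separator and one leaf for every variable. -/
structure IsCertificate (T : Set (DVar ι κ ⊕ W)) : Prop where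
  root_mem : D.root ∈ T
  and_mem : ∀ w, Sum.inr w ∈ T → D.gate w = Gate.and → ∀ u ∈ D.children w, u ∈ T
  or_mem : ∀ w, Sum.inr w ∈ T → D.gate w = Gate.or → ∃ u ∈ D.children w, u ∈ T
  exists_edge : ∀ v ∈ T, v ≠ D.root → ∃ p ∈ T, D.Edge p v
  mem_leaves : ∀ x, Sum.inl x ∈ T → x ∈ D.leaves
  separator : ∀ i S, D.IsSeparator i S → ∃! u, u ∈ S ∧ u ∈ T
  leaf : ∀ i, ∃! x : DVar ι κ, x.1 = i ∧ Sum.inl x ∈ T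

/-- A set of nodes that contains the root, all inputs of its conjunctions and an input of each of
its disjunctions. -/
structure IsSatisfied (E : Set (DVar ι κ ⊕ W)) : Prop where
  root_mem : D.root ∈ E
  and_mem : ∀ w, Sum.inr w ∈ E → D.gate w = Gate.and → ∀ u ∈ D.children w, u ∈ E
  or_mem : ∀ w, Sum.inr w ∈ E → D.gate w = Gate.or → ∃ u ∈ D.children w, u ∈ E

/-- The edges of `D` without those to the inputs of a disjunction `w` other than `sel w`. -/
def SelEdge (sel : W → DVar ι κ ⊕ W) (v u : DVar ι κ ⊕ W) : Prop :=
  ∃ w, v = Sum.inr w ∧ u ∈ D.children w ∧ (D.gate w = Gate.or → u = sel w)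

variable {D}

theorem SelEdge.edge {sel : W → DVar ι κ ⊕ W} {v u : DVar ι κ ⊕ W} (h : D.SelEdge sel v u) :
    D.Edge v u := by
  obtain ⟨w, rfl, hu, -⟩ := h
  exact ⟨w, rfl, hu⟩

theorem mem_H_of_edge {i : ι} {v u : DVar ι κ ⊕ W} (h : D.Edge v u) (hu : u ∈ D.H i) :
    v ∈ D.H i := by
  obtain ⟨s, hs, hp⟩ := hu
  exact ⟨s, hs, .head h hp⟩

theorem root_mem_H (i : ι) : D.root ∈ D.H i := by
  obtain ⟨s, hs⟩ := D.exists_leaf i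
  exact ⟨s, hs, D.reach_leaf _ hs⟩

theorem not_edge_inl (x : DVar ι κ) (u : DVar ι κ ⊕ W) : ¬ D.Edge (Sum.inl x) u := by
  rintro ⟨w, h, -⟩
  cases h

theorem inl_mem_H {x : DVar ι κ} {i : ι} : Sum.inl x ∈ D.H i ↔ x ∈ D.leaves ∧ x.1 = i := by
  constructor
  · rintro ⟨s, hs, hp⟩
    rcases hp.cases_head with h | ⟨u, hu, -⟩
    · obtain rfl := Sum.inl_injective h
      exact ⟨hs, rfl⟩
    · exact absurd hu (not_edge_inl x u)
  · rintro ⟨hx, rfl⟩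
    exact ⟨x.2, hx, .refl⟩

theorem not_edge_root (v : DVar ι κ ⊕ W) : ¬ D.Edge v D.root := by
  rintro ⟨w, rfl, hw⟩
  exact D.acyclic _ (Relation.TransGen.tail' (D.reach_inner w) ⟨w, rfl, hw⟩)

theorem wellFounded_edge [Finite ι] [∀ i, Finite (κ i)] [Finite W] :
    WellFounded (flip D.Edge) := by
  have : IsTrans _ (Relation.TransGen (flip D.Edge)) := ⟨fun _ _ _ => Relation.TransGen.trans⟩
  have : Std.Irrefl (Relation.TransGen (flip D.Edge)) :=
    ⟨fun v hv => D.acyclic v (Relation.transGen_swap.1 hv)⟩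
  exact Subrelation.wf (fun h => Relation.TransGen.single h)
    (Finite.wellFounded_of_trans_of_irrefl (Relation.TransGen (flip D.Edge)))

theorem exists_mem_H_of_mem_leaves_or_inner [Finite ι] [∀ i, Finite (κ i)] [Finite W]
    (v : DVar ι κ ⊕ W) (hv : ∀ x, v = Sum.inl x → x ∈ D.leaves) : ∃ i, v ∈ D.H i := by
  induction v using wellFounded_edge (D := D) |>.induction with
  | _ v ih =>
  rcases v with x | w
  · exact ⟨x.1, inl_mem_H.2 ⟨hv x rfl, rfl⟩⟩
  · obtain ⟨u, hu⟩ := D.children_nonempty w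
    have he : D.Edge (Sum.inr w) u := ⟨w, rfl, hu⟩
    obtain ⟨i, hi⟩ := ih u he fun x hx => D.child_leaf w x (hx ▸ hu)
    exact ⟨i, mem_H_of_edge he hi⟩

theorem exists_child_mem_H {i : ι} {w : W} (h : Sum.inr w ∈ D.H i) :
    ∃ u ∈ D.children w, u ∈ D.H i := by
  obtain ⟨s, hs, hp⟩ := h
  rcases hp.cases_head with h | ⟨u, ⟨w', hw, hu⟩, hp⟩
  · cases h
  · obtain rfl := Sum.inr_injective hw
    exact ⟨u, hu, s, hs, hp⟩

/-- The restriction of `SelEdge` to the subgraph `D_i`. -/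
def SelEdgeOn (D : NNF ι κ W) (sel : W → DVar ι κ ⊕ W) (i : ι) (v u : DVar ι κ ⊕ W) : Prop :=
  D.SelEdge sel v u ∧ u ∈ D.H i

/-- In `D_i`, a node has at most one selected input: a conjunction because of decomposability. -/
theorem rightUnique_selEdgeOn (hdec : D.Decomposable) (sel : W → DVar ι κ ⊕ W) (i : ι) :
    Relator.RightUnique (D.SelEdgeOn sel i) := by
  rintro v u u' ⟨⟨w, rfl, hu, hs⟩, hi⟩ ⟨⟨w', hw, hu', hs'⟩, hi'⟩
  obtain rfl := Sum.inr_injective hw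
  cases hg : D.gate w with
  | or => exact (hs hg).trans (hs' hg).symm
  | and =>
    by_contra hne
    exact Set.disjoint_left.1 (hdec w hg u hu u' hu' hne) hi hi'

theorem selEdgeOn_of_selEdge {sel : W → DVar ι κ ⊕ W} {i : ι} {v u : DVar ι κ ⊕ W}
    (h : Relation.ReflTransGen (D.SelEdge sel) v u) (hu : u ∈ D.H i) :
    Relation.ReflTransGen (D.SelEdgeOn sel i) v u := by
  induction h with
  | refl => exact .refl
  | tail _ he ih => exact (ih (mem_H_of_edge he.edge hu)).tail ⟨he, hu⟩

theorem exists_selEdgeOn_leaf [Finite ι] [∀ i, Finite (κ i)] [Finite W] (hsmooth : D.Smooth)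
    {E : Set (DVar ι κ ⊕ W)} (hE : D.IsSatisfied E) {sel : W → DVar ι κ ⊕ W}
    (hsel : ∀ w, Sum.inr w ∈ E → D.gate w = Gate.or → sel w ∈ D.children w ∧ sel w ∈ E)
    {i : ι} (v : DVar ι κ ⊕ W) (hv : v ∈ D.H i) (hvE : v ∈ E) :
    ∃ x : DVar ι κ, x.1 = i ∧ Sum.inl x ∈ D.H i ∧
      Relation.ReflTransGen (D.SelEdgeOn sel i) v (Sum.inl x) := by
  induction v using wellFounded_edge (D := D) |>.induction with
  | _ v ih =>
  rcases v with x | w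
  · exact ⟨x, (inl_mem_H.1 hv).2, hv, .refl⟩
  · have key : ∃ u, D.SelEdgeOn sel i (Sum.inr w) u ∧ u ∈ E := by
      cases hg : D.gate w with
      | or =>
        obtain ⟨h1, h2⟩ := hsel w hvE hg
        refine ⟨sel w, ⟨⟨w, rfl, h1, fun _ => rfl⟩, ?_⟩, h2⟩
        change i ∈ D.vars (sel w)
        rwa [hsmooth w hg _ h1]
      | and =>
        obtain ⟨u, hu, hi⟩ := exists_child_mem_H hv
        exact ⟨u, ⟨⟨w, rfl, hu, fun h => by simp [hg] at h⟩, hi⟩, hE.and_mem w hvE hg u hu⟩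
    obtain ⟨u, hu, huE⟩ := key
    obtain ⟨x, hx, hxH, hp⟩ := ih u hu.1.edge hu.2 huE
    exact ⟨x, hx, hxH, .head hu hp⟩

theorem reflTransGen_of_mem_chain {α : Type*} {r : α → α → Prop} {a b : α} {p : List α}
    (hp : p.IsChain r) (ha : p.head? = some a) (hb : b ∈ p) : Relation.ReflTransGen r a b := by
  induction p generalizing a with
  | nil => simp at hb
  | cons c q ih =>
    obtain rfl : c = a := by simpa using ha
    rcases List.mem_cons.1 hb with rfl | hb
    · exact .refl
    · cases q with
      | nil => simp at hb
      | cons c' q =>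
        rw [List.isChain_cons_cons] at hp
        exact .head hp.1 (ih hp.2 rfl hb)

theorem exists_chain_of_reflTransGen {α : Type*} {r : α → α → Prop} {a b d : α}
    (h : Relation.ReflTransGen r a b) {p : List α} (hp : p.IsChain r) (hb : p.head? = some b)
    (hd : p.getLast? = some d) :
    ∃ q : List α, q.IsChain r ∧ q.head? = some a ∧ q.getLast? = some d ∧ p ⊆ q := by
  induction h using Relation.ReflTransGen.head_induction_on with
  | refl => exact ⟨p, hp, hb, hd, List.Subset.refl _⟩
  | @head a c hac _ ih =>
    obtain ⟨q, hq, hqc, hqd, hpq⟩ := ih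
    refine ⟨a :: q, ?_, rfl, ?_, fun x hx => List.mem_cons_of_mem _ (hpq hx)⟩
    · cases q with
      | nil => simp at hqc
      | cons c' q =>
        obtain rfl : c' = c := by simpa using hqc
        exact List.IsChain.cons_cons hac hq
    · rw [List.getLast?_cons, hqd]; rfl

/-- Nodes on a directed path of `D_i` from the root lie on a directed path from the root to a leaf,
as long as the path can be continued to a leaf. -/
theorem exists_isRootLeafPath {sel : W → DVar ι κ ⊕ W} {i : ι} {u u' : DVar ι κ ⊕ W}
    {x : DVar ι κ}
    (hu : Relation.ReflTransGen (D.SelEdgeOn sel i) D.root u)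
    (hu' : Relation.ReflTransGen (D.SelEdgeOn sel i) u u')
    (hx : Relation.ReflTransGen (D.SelEdgeOn sel i) u' (Sum.inl x)) (hxH : Sum.inl x ∈ D.H i) :
    ∃ p, D.IsRootLeafPath i p ∧ p.IsChain (D.SelEdgeOn sel i) ∧ u ∈ p ∧ u' ∈ p := by
  have hh : ∀ {q : List (DVar ι κ ⊕ W)} {v}, q.head? = some v → v ∈ q := fun h =>
    List.mem_of_mem_head? h
  obtain ⟨p₁, c₁, h₁, l₁, -⟩ := exists_chain_of_reflTransGen hx
    (List.IsChain.singleton (Sum.inl x)) rfl rfl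
  obtain ⟨p₂, c₂, h₂, l₂, s₂⟩ := exists_chain_of_reflTransGen hu' c₁ h₁ l₁
  obtain ⟨p₃, c₃, h₃, l₃, s₃⟩ := exists_chain_of_reflTransGen hu c₂ h₂ l₂
  refine ⟨p₃, ⟨c₃.imp fun _ _ h => h.1.edge, ?_, h₃, x, (inl_mem_H.1 hxH).1, l₃⟩, c₃,
    s₃ (hh h₂), s₃ (s₂ (hh h₁))⟩
  intro v hv
  rcases (reflTransGen_of_mem_chain c₃ h₃ hv).cases_tail with h | ⟨_, -, h⟩
  · exact h ▸ root_mem_H i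
  · exact h.2

/-- The nodes reachable by selected edges form a certificate: by smoothness and decomposability they
meet each `D_i` in a single path from the root to a leaf. -/
theorem isCertificate_of_sel [Finite ι] [∀ i, Finite (κ i)] [Finite W] (hdec : D.Decomposable)
    (hsmooth : D.Smooth) {E : Set (DVar ι κ ⊕ W)} (hE : D.IsSatisfied E)
    {sel : W → DVar ι κ ⊕ W}
    (hsel : ∀ w, Sum.inr w ∈ E → D.gate w = Gate.or → sel w ∈ D.children w ∧ sel w ∈ E) :
    D.IsCertificate {v | Relation.ReflTransGen (D.SelEdge sel) D.root v} ∧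
      {v | Relation.ReflTransGen (D.SelEdge sel) D.root v} ⊆ E := by
  have hTE : {v | Relation.ReflTransGen (D.SelEdge sel) D.root v} ⊆ E := by
    intro v hv
    induction hv with
    | refl => exact hE.root_mem
    | tail _ he ih =>
      obtain ⟨w, rfl, hu, hs⟩ := he
      cases hg : D.gate w with
      | or => exact hs hg ▸ (hsel w ih hg).2
      | and => exact hE.and_mem w ih hg _ hu
  have hleaf : ∀ i, ∀ v, Relation.ReflTransGen (D.SelEdge sel) D.root v → v ∈ D.H i →
      ∃ x : DVar ι κ, x.1 = i ∧ Sum.inl x ∈ D.H i ∧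
        Relation.ReflTransGen (D.SelEdgeOn sel i) v (Sum.inl x) := fun i v hv hvi =>
    exists_selEdgeOn_leaf hsmooth hE hsel v hvi (hTE hv)
  have hsub : ∀ {i v u}, Relation.ReflTransGen (D.SelEdgeOn sel i) v u →
      Relation.ReflTransGen (D.SelEdge sel) v u := fun h =>
    Relation.ReflTransGen.mono (fun _ _ h => h.1) _ _ h
  have hml : ∀ x, Relation.ReflTransGen (D.SelEdge sel) D.root (Sum.inl x) → x ∈ D.leaves := by
    intro x hx
    rcases hx.cases_tail with h | ⟨p, -, w, rfl, hw, -⟩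
    · exact D.root_leaf x h.symm
    · exact D.child_leaf w x hw
  refine ⟨⟨.refl, fun w hw hg u hu => hw.tail ⟨w, rfl, hu, fun h => by simp [hg] at h⟩,
    fun w hw hg => ?_, fun v hv hne => ?_, hml, fun i S hS => ?_, fun i => ?_⟩, hTE⟩
  · have h := (hsel w (hTE hw) hg).1
    exact ⟨sel w, h, hw.tail ⟨w, rfl, h, fun _ => rfl⟩⟩
  · rcases hv.cases_tail with h | ⟨p, hp, he⟩
    · exact absurd h hne
    · exact ⟨p, hp, he.edge⟩
  · have huniq : ∀ u u' : DVar ι κ ⊕ W, u ∈ S → u' ∈ S →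
        Relation.ReflTransGen (D.SelEdgeOn sel i) D.root u →
        Relation.ReflTransGen (D.SelEdge sel) D.root u' →
        Relation.ReflTransGen (D.SelEdgeOn sel i) u u' → u = u' := by
      intro u u' hu hu' hr hr' hp
      obtain ⟨x, -, hxH, hx⟩ := hleaf i u' hr' (hS.1 u' hu')
      obtain ⟨p, hp, -, hup, hup'⟩ := exists_isRootLeafPath hr hp hx hxH
      exact (hS.2 p hp).unique ⟨hup, hu⟩ ⟨hup', hu'⟩
    have hex : ∃ u, u ∈ S ∧ Relation.ReflTransGen (D.SelEdge sel) D.root u := by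
      obtain ⟨x, -, hxH, hx⟩ := hleaf i D.root .refl (root_mem_H i)
      obtain ⟨p, hp, hc, -, -⟩ := exists_isRootLeafPath .refl .refl hx hxH
      obtain ⟨u, ⟨hup, huS⟩, -⟩ := hS.2 p hp
      refine ⟨u, huS, ?_⟩
      obtain ⟨-, -, hhead, -⟩ := hp
      exact hsub (reflTransGen_of_mem_chain hc hhead hup)
    obtain ⟨u, huS, hu⟩ := hex
    refine ⟨u, ⟨huS, hu⟩, ?_⟩
    rintro u' ⟨huS', hu'⟩
    have h := selEdgeOn_of_selEdge hu (hS.1 u huS)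
    have h' := selEdgeOn_of_selEdge hu' (hS.1 u' huS')
    rcases Relation.ReflTransGen.total_of_right_unique (rightUnique_selEdgeOn hdec sel i) h h' with
      hp | hp
    · exact (huniq u u' huS huS' h hu' hp).symm
    · exact huniq u' u huS' huS h' hu hp
  · obtain ⟨x, hx, hxH, hp⟩ := hleaf i D.root .refl (root_mem_H i)
    refine ⟨x, ⟨hx, hsub hp⟩, ?_⟩
    rintro x' ⟨hx', hp'⟩
    have hp' := selEdgeOn_of_selEdge hp' (inl_mem_H.2 ⟨hml x' hp', hx'⟩)
    have hend : ∀ y z : DVar ι κ,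
        Relation.ReflTransGen (D.SelEdgeOn sel i) (Sum.inl y) (Sum.inl z) → z = y := by
      intro y z h
      rcases h.cases_head with h | ⟨u, hu, -⟩
      · exact (Sum.inl_injective h).symm
      · exact absurd hu.1.edge (not_edge_inl y u)
    rcases Relation.ReflTransGen.total_of_right_unique (rightUnique_selEdgeOn hdec sel i) hp
      hp' with h | h
    · exact hend _ _ h
    · exact (hend _ _ h).symm

/-- Every path from the root in a satisfied set is contained in a certificate: select its edges. -/
theorem exists_certificate_of_path [Finite ι] [∀ i, Finite (κ i)] [Finite W]
    (hdec : D.Decomposable) (hsmooth : D.Smooth) {E : Set (DVar ι κ ⊕ W)} (hE : D.IsSatisfied E)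
    {v : DVar ι κ ⊕ W} (hv : Relation.ReflTransGen (fun p u => D.Edge p u ∧ u ∈ E) D.root v) :
    ∃ T ⊆ E, D.IsCertificate T ∧ v ∈ T := by
  classical
  suffices h : ∃ sel : W → DVar ι κ ⊕ W,
      (∀ w, Sum.inr w ∈ E → D.gate w = Gate.or → sel w ∈ D.children w ∧ sel w ∈ E) ∧
      Relation.ReflTransGen (D.SelEdge sel) D.root v by
    obtain ⟨sel, hsel, hr⟩ := h
    obtain ⟨h1, h2⟩ := isCertificate_of_sel hdec hsmooth hE hsel
    exact ⟨_, h2, h1, hr⟩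
  induction hv with
  | refl =>
    have : ∀ w, ∃ u, Sum.inr w ∈ E → D.gate w = Gate.or → u ∈ D.children w ∧ u ∈ E := by
      intro w
      by_cases h : Sum.inr w ∈ E ∧ D.gate w = Gate.or
      · obtain ⟨u, hu⟩ := hE.or_mem w h.1 h.2
        exact ⟨u, fun _ _ => hu⟩
      · exact ⟨Sum.inr w, fun h1 h2 => absurd ⟨h1, h2⟩ h⟩
    choose sel hsel using this
    exact ⟨sel, hsel, .refl⟩
  | @tail p u _ he ih =>
    obtain ⟨sel, hsel, hr⟩ := ih
    obtain ⟨⟨w, rfl, hu⟩, huE⟩ := he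
    refine ⟨Function.update sel w u, fun w' hw' hg => ?_, ?_⟩
    · by_cases h : w' = w
      · subst h
        simpa using ⟨hu, huE⟩
      · simpa [h] using hsel w' hw' hg
    · -- As `D` is acyclic, the path to `w` does not use the changed selection at `w`.
      have : Relation.ReflTransGen (D.SelEdge (Function.update sel w u)) D.root (Sum.inr w) := by
        generalize D.root = r at hr ⊢
        induction hr using Relation.ReflTransGen.head_induction_on with
        | refl => exact .refl
        | head hac hp ih =>
          refine .head ?_ ih
          obtain ⟨w', rfl, hc, hs⟩ := hac
          have hne : w' ≠ w := by
            rintro rfl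
            exact D.acyclic _ (Relation.TransGen.head' (⟨w', rfl, hc⟩ : D.Edge _ _)
              (Relation.ReflTransGen.mono (fun _ _ h => h.edge) _ _ hp))
          exact ⟨w', rfl, hc, by simpa [hne] using hs⟩
      exact this.tail ⟨w, rfl, hu, fun _ => by simp⟩

theorem exists_certificate [Finite ι] [∀ i, Finite (κ i)] [Finite W]
    (hdec : D.Decomposable) (hsmooth : D.Smooth) {E : Set (DVar ι κ ⊕ W)} (hE : D.IsSatisfied E) :
    ∃ T ⊆ E, D.IsCertificate T := by
  obtain ⟨T, hT, hc, -⟩ := exists_certificate_of_path hdec hsmooth hE .refl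
  exact ⟨T, hT, hc⟩

theorem exists_certificate_mem [Finite ι] [∀ i, Finite (κ i)] [Finite W]
    (hdec : D.Decomposable) (hsmooth : D.Smooth) {E : Set (DVar ι κ ⊕ W)} (hE : D.IsSatisfied E)
    (hpar : ∀ v ∈ E, v ≠ D.root → ∃ p ∈ E, D.Edge p v) {v : DVar ι κ ⊕ W} (hv : v ∈ E) :
    ∃ T ⊆ E, D.IsCertificate T ∧ v ∈ T := by
  refine exists_certificate_of_path hdec hsmooth hE ?_
  have hwf : WellFounded (Relation.TransGen D.Edge) := by
    have : IsTrans _ (Relation.TransGen D.Edge) := ⟨fun _ _ _ => Relation.TransGen.trans⟩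
    have : Std.Irrefl (Relation.TransGen D.Edge) := ⟨D.acyclic⟩
    exact Finite.wellFounded_of_trans_of_irrefl _
  induction v using hwf.induction with
  | _ v ih =>
  by_cases h : v = D.root
  · rw [h]
  · obtain ⟨p, hp, he⟩ := hpar v hv h
    exact (ih p (.single he) hp).tail ⟨he, hv⟩

end NNF

/-! ### Certificates and the base clauses -/

namespace NNF

variable {ι : Type*} {κ : ι → Type*} {W : Type*} {D : NNF ι κ W}
variable {𝒮 : ι → Set (Finset (DVar ι κ ⊕ W))}

theorem satisfied_of_closed {Λ : Set (Lit (DVar ι κ ⊕ W))} (h : Closed D.base Λ) :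
    D.IsSatisfied {v | .neg v ∉ Λ} where
  root_mem := fun hr => h.compl_notMem _ hr (h.unit (Or.inr rfl))
  and_mem w hw hg u hu hn :=
    hw (h.pair (Or.inl (Or.inl (Or.inl (Or.inr ⟨w, hg, u, hu, rfl⟩)))) hn)
  or_mem w hw hg := by
    by_contra! hn
    refine hw (h.mem_of_unit _ (Or.inl (Or.inl (Or.inl (Or.inl ⟨w, hg, rfl⟩)))) _
      (Or.inl rfl) ?_)
    rintro m (hm | ⟨u, hu, rfl⟩) hne
    · exact absurd hm hne
    · exact not_not.1 (hn u hu)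

theorem exists_edge_of_closed {Λ : Set (Lit (DVar ι κ ⊕ W))} (h : Closed D.base Λ)
    {v : DVar ι κ ⊕ W} (hv : .neg v ∉ Λ) (hin : ∃ p, D.Edge p v) :
    ∃ p, .neg p ∉ Λ ∧ D.Edge p v := by
  by_contra! hn
  refine hv (h.mem_of_unit _ (Or.inl (Or.inl (Or.inr ⟨v, hin, rfl⟩))) _ (Or.inl rfl) ?_)
  rintro m (hm | ⟨p, hp, rfl⟩) hne
  · exact absurd hm hne
  · by_contra hp'
    exact hn p hp' hp

theorem mem_leaves_of_closed {Λ : Set (Lit (DVar ι κ ⊕ W))} (h : Closed D.base Λ)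
    {x : DVar ι κ} (hx : .neg (Sum.inl x) ∉ Λ) : x ∈ D.leaves := by
  by_contra hn
  exact hx (h.unit (Or.inl (Or.inr ⟨x, hn, rfl⟩)))

/-- A node different from the root has a predecessor, unless it is a domain variable that does not
occur in `D`. -/
theorem exists_edge {v : DVar ι κ ⊕ W} (hv : ∀ x, v = Sum.inl x → x ∈ D.leaves)
    (hne : v ≠ D.root) : ∃ p, D.Edge p v := by
  have hr : Relation.ReflTransGen D.Edge D.root v := by
    rcases v with x | w
    · exact D.reach_leaf x (hv x rfl)
    · exact D.reach_inner w
  rcases hr.cases_tail with h | ⟨p, -, he⟩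
  · exact absurd h hne
  · exact ⟨p, he⟩

theorem IsCertificate.holds_base {T : Set (DVar ι κ ⊕ W)} (hT : D.IsCertificate T)
    {a : DVar ι κ ⊕ W → Bool} (ha : ∀ v, a v = true ↔ v ∈ T) : D.base.Holds a := by
  have hneg : ∀ v, v ∉ T → (Lit.neg v).Holds a := fun v hv => by
    simpa [Lit.Holds] using fun h => hv ((ha v).1 h)
  rintro C ((((⟨w, hg, rfl⟩ | ⟨w, hg, u, hu, rfl⟩) | ⟨v, hv, rfl⟩) | ⟨x, hx, rfl⟩) | rfl)
  · by_cases hw : Sum.inr w ∈ T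
    · obtain ⟨u, hu, huT⟩ := hT.or_mem w hw hg
      exact ⟨.pos u, Or.inr ⟨u, hu, rfl⟩, (ha u).2 huT⟩
    · exact ⟨_, Or.inl rfl, hneg _ hw⟩
  · by_cases hw : Sum.inr w ∈ T
    · exact ⟨.pos u, Or.inr rfl, (ha u).2 (hT.and_mem w hw hg u hu)⟩
    · exact ⟨_, Or.inl rfl, hneg _ hw⟩
  · by_cases hvT : v ∈ T
    · obtain ⟨p, hp, he⟩ := hT.exists_edge v hvT (by
        rintro rfl
        exact hv.elim not_edge_root)
      exact ⟨.pos p, Or.inr ⟨p, he, rfl⟩, (ha p).2 hp⟩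
    · exact ⟨_, Or.inl rfl, hneg _ hvT⟩
  · exact ⟨_, rfl, hneg _ fun h => hx (hT.mem_leaves x h)⟩
  · exact ⟨_, rfl, (ha _).2 hT.root_mem⟩

/-- A node of a certificate evaluates to `1` if all leaves in the certificate do. -/
theorem IsCertificate.eval [Finite ι] [∀ i, Finite (κ i)] [Finite W] {T : Set (DVar ι κ ⊕ W)}
    (hT : D.IsCertificate T) {a : DVar ι κ → Bool} (ha : ∀ x, Sum.inl x ∈ T → a x = true)
    (v : DVar ι κ ⊕ W) (hv : v ∈ T) : D.Eval a v := by
  induction v using wellFounded_edge (D := D) |>.induction with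
  | _ v ih =>
  rcases v with x | w
  · exact .leaf x (ha x hv)
  · cases hg : D.gate w with
    | and => exact .and w hg fun u hu => ih u ⟨w, rfl, hu⟩ (hT.and_mem w hv hg u hu)
    | or =>
      obtain ⟨u, hu, huT⟩ := hT.or_mem w hv hg
      exact .or w u hg hu (ih u ⟨w, rfl, hu⟩ huT)

theorem satisfied_eval {a : DVar ι κ → Bool} (h : D.fn a) : D.IsSatisfied {v | D.Eval a v} where
  root_mem := h
  and_mem w hw hg u hu := by
    cases hw with
    | and _ _ h => exact h u hu
    | or _ _ hg' => simp [hg] at hg'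
  or_mem w hw hg := by
    cases hw with
    | and _ hg' => simp [hg] at hg'
    | or _ u _ hu h => exact ⟨u, hu, h⟩

/-! ### Completeness of the combined formulas -/

/-- The formula consisting of the clauses `D.base` and of a formula `c S` for each separator `S`. -/
def withSeparators {U : Type*} (D : NNF ι κ W) (ν : DVar ι κ ⊕ W → U) (c : Sep 𝒮 → CNF U) :
    CNF U :=
  D.base.rename ν ∪ {C | ∃ S : Sep 𝒮, C ∈ c S}

/-- The variables in the second summand consist of the inner nodes, embedded by `ν`, and of the
disjoint families `y S` of auxiliary variables, one for each separator: values can be prescribed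
for nodes and auxiliary variables, and there are no other variables. -/
structure IsVarSplit {Y : Type*} {J : Sep 𝒮 → Type*} (ν : DVar ι κ ⊕ W → DVar ι κ ⊕ Y)
    (y : ∀ S, J S → DVar ι κ ⊕ Y) : Prop where
  apply_inl : ∀ x, ν (Sum.inl x) = Sum.inl x
  exists_glue : ∀ (f : DVar ι κ ⊕ W → Bool) (g : ∀ S, J S → Bool),
    ∃ a : DVar ι κ ⊕ Y → Bool, (∀ v, a (ν v) = f v) ∧ ∀ S j, a (y S j) = g S j
  cover : ∀ z, (∃ v, z = ν v) ∨ ∃ S j, z = y S j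

section
variable {Y : Type*} {J : Sep 𝒮 → Type*} {ν : DVar ι κ ⊕ W → DVar ι κ ⊕ Y}
  {y : ∀ S, J S → DVar ι κ ⊕ Y} {c : Sep 𝒮 → CNF (DVar ι κ ⊕ Y)}
  {b : ∀ S : Sep 𝒮, {v // v ∈ S.1} → J S → Bool}

theorem closed_base {Λ : Set (Lit (DVar ι κ ⊕ Y))} (h : Closed (D.withSeparators ν c) Λ) :
    Closed D.base {l | l.rename ν ∈ Λ} :=
  (h.mono Set.subset_union_left).rename

theorem closed_separator {Λ : Set (Lit (DVar ι κ ⊕ Y))} (h : Closed (D.withSeparators ν c) Λ)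
    (S : Sep 𝒮) : Closed (c S) Λ :=
  h.mono fun _ hC => Or.inr ⟨S, hC⟩

theorem IsCertificate.existsUnique_mem (h𝒮 : D.IsSeparatorCover 𝒮) {T : Set (DVar ι κ ⊕ W)}
    (hT : D.IsCertificate T) (S : Sep 𝒮) : ∃! u, u ∈ S.1 ∧ u ∈ T := by
  obtain ⟨i, hi⟩ := S.2
  exact hT.separator i S.1 ((h𝒮 i).1 S.1 hi)

theorem exists_sep_mem [Finite ι] [∀ i, Finite (κ i)] [Finite W] (h𝒮 : D.IsSeparatorCover 𝒮)
    {v : DVar ι κ ⊕ W} (hv : ∀ x, v = Sum.inl x → x ∈ D.leaves) (hne : v ≠ D.root) :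
    ∃ S : Sep 𝒮, v ∈ S.1 := by
  obtain ⟨i, hi⟩ := exists_mem_H_of_mem_leaves_or_inner v hv
  have : v ∈ D.H i \ {D.root} := ⟨hi, hne⟩
  rw [← (h𝒮 i).2] at this
  obtain ⟨S, hS, hvS⟩ := this
  exact ⟨⟨S, i, hS⟩, hvS⟩

/-- A certificate, completed by the values of the auxiliary variables that belong to its
intersections with the separators, is a model. -/
theorem IsCertificate.exists_model (hν : IsVarSplit ν y) (h𝒮 : D.IsSeparatorCover 𝒮)
    (hc : ∀ S, AmoGadget (c S) (fun v : {v // v ∈ S.1} => ν v) (y S) (b S))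
    {T : Set (DVar ι κ ⊕ W)} (hT : D.IsCertificate T) :
    ∃ a, (D.withSeparators ν c).Holds a ∧ (∀ v, a (ν v) = true ↔ v ∈ T) ∧
      ∀ S (u : {v // v ∈ S.1}), u.1 ∈ T → ∀ j, a (y S j) = b S u j := by
  classical
  choose u hu huniq using hT.existsUnique_mem h𝒮
  obtain ⟨a, ha, hg⟩ := hν.exists_glue (fun v => decide (v ∈ T)) fun S => b S ⟨u S, (hu S).1⟩
  have ha : ∀ v, a (ν v) = true ↔ v ∈ T := fun v => by simp [ha]
  refine ⟨a, ?_, ha, fun S v hv j => ?_⟩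
  · rintro C (hC | ⟨S, hC⟩)
    · exact holds_rename (hT.holds_base ha) C hC
    · refine (hc S).sat ⟨u S, (hu S).1⟩ a (fun v => ?_) (hg S) C hC
      rw [ha, Subtype.ext_iff]
      exact ⟨fun hv => huniq S v ⟨v.2, hv⟩, fun hv => hv ▸ (hu S).2⟩
  · obtain rfl : v = ⟨u S, (hu S).1⟩ := Subtype.ext (huniq S v ⟨v.2, hv⟩)
    exact hg S j

/-- The true nodes of a closed set belong to every certificate without a falsified node: a
separator through a true node has no other node that is not falsified. -/
theorem IsCertificate.mem_of_pos [Finite ι] [∀ i, Finite (κ i)] [Finite W]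
    (h𝒮 : D.IsSeparatorCover 𝒮)
    (hc : ∀ S, AmoGadget (c S) (fun v : {v // v ∈ S.1} => ν v) (y S) (b S))
    {Λ : Set (Lit (DVar ι κ ⊕ Y))} (hΛ : Closed (D.withSeparators ν c) Λ)
    {T : Set (DVar ι κ ⊕ W)} (hT : D.IsCertificate T) (hTΛ : ∀ v ∈ T, .neg (ν v) ∉ Λ)
    {v : DVar ι κ ⊕ W} (hv : .pos (ν v) ∈ Λ) : v ∈ T := by
  by_cases hr : v = D.root
  · exact hr ▸ hT.root_mem
  have hvn : .neg (ν v) ∉ Λ := hΛ.compl_notMem _ hv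
  obtain ⟨S, hS⟩ := exists_sep_mem (D := D) h𝒮 (v := v) (by
    rintro x rfl
    exact mem_leaves_of_closed (closed_base hΛ) hvn) hr
  obtain ⟨u, ⟨huS, huT⟩, -⟩ := hT.existsUnique_mem h𝒮 S
  have := (hc S).eq_of_pos Λ (closed_separator hΛ S) ⟨u, huS⟩ (hTΛ u huT) ⟨v, hS⟩ hv
  obtain rfl : v = u := congrArg Subtype.val this
  exact huT

/-- A certificate without a falsified node yields a model in which a closed set holds. -/
theorem IsCertificate.exists_model_of_closed [Finite ι] [∀ i, Finite (κ i)] [Finite W]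
    (hν : IsVarSplit ν y) (h𝒮 : D.IsSeparatorCover 𝒮)
    (hc : ∀ S, AmoGadget (c S) (fun v : {v // v ∈ S.1} => ν v) (y S) (b S))
    {Λ : Set (Lit (DVar ι κ ⊕ Y))} (hΛ : Closed (D.withSeparators ν c) Λ)
    {T : Set (DVar ι κ ⊕ W)} (hT : D.IsCertificate T) (hTΛ : ∀ v ∈ T, .neg (ν v) ∉ Λ) :
    ∃ a, (D.withSeparators ν c).Holds a ∧ (∀ l ∈ Λ, l.Holds a) ∧
      (∀ v, a (ν v) = true ↔ v ∈ T) ∧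
      ∀ S (u : {v // v ∈ S.1}), u.1 ∈ T → ∀ j, a (y S j) = b S u j := by
  obtain ⟨a, ha, haT, hay⟩ := hT.exists_model hν h𝒮 hc
  refine ⟨a, ha, fun l hl => ?_, haT, hay⟩
  rcases l with z | z
  · rcases hν.cover z with ⟨v, rfl⟩ | ⟨S, j, rfl⟩
    · exact (haT v).2 (hT.mem_of_pos h𝒮 hc hΛ hTΛ hl)
    · obtain ⟨u, ⟨huS, huT⟩, -⟩ := hT.existsUnique_mem h𝒮 S
      exact (hay S ⟨u, huS⟩ huT j).trans
        ((hc S).pos_aux Λ (closed_separator hΛ S) ⟨u, huS⟩ (hTΛ u huT) j hl)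
  · rcases hν.cover z with ⟨v, rfl⟩ | ⟨S, j, rfl⟩
    · have : ¬ a (ν v) = true := fun h => hTΛ v ((haT v).1 h) hl
      simpa [Lit.Holds] using this
    · obtain ⟨u, ⟨huS, huT⟩, -⟩ := hT.existsUnique_mem h𝒮 S
      exact (hay S ⟨u, huS⟩ huT j).trans
        ((hc S).neg_aux Λ (closed_separator hΛ S) ⟨u, huS⟩ (hTΛ u huT) j hl)

theorem isEncoding_withSeparators [Finite ι] [∀ i, Finite (κ i)] [Finite W]
    (hdec : D.Decomposable) (hsmooth : D.Smooth)
    (hν : IsVarSplit ν y) (h𝒮 : D.IsSeparatorCover 𝒮)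
    (hc : ∀ S, AmoGadget (c S) (fun v : {v // v ∈ S.1} => ν v) (y S) (b S)) :
    IsEncoding (D.withSeparators ν c) D.fn' := by
  intro a
  constructor
  · rintro ⟨hf, heo⟩
    obtain ⟨T, hTE, hT⟩ := exists_certificate hdec hsmooth (satisfied_eval hf)
    obtain ⟨A, hA, hAT, -⟩ := hT.exists_model hν h𝒮 hc
    refine ⟨A ∘ Sum.inr, ?_⟩
    -- The leaves of the certificate are the true domain variables, as there is one per variable.
    have hlt : ∀ x, Sum.inl x ∈ T → a x = true := fun x hx => by
      cases hTE hx with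
      | leaf _ h => exact h
    have : A ∘ Sum.inl = a := by
      funext x
      rw [Bool.eq_iff_iff, Function.comp_apply, ← hν.apply_inl, hAT]
      refine ⟨hlt x, fun hx => ?_⟩
      obtain ⟨x', ⟨hi, hx'⟩, -⟩ := hT.leaf x.1
      rwa [(heo x.1).unique ⟨rfl, hx⟩ ⟨hi, hlt x' hx'⟩]
    rwa [← this, Sum.elim_comp_inl_inr]
  · rintro ⟨b', hb⟩
    -- The literals true in a model form a closed set, so the true nodes form a certificate.
    have hΛ := closed_of_holds hb
    have hbase := closed_base hΛ
    obtain ⟨T, hTE, hT⟩ := exists_certificate hdec hsmooth (satisfied_of_closed hbase)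
    have ht : ∀ x, Sum.inl x ∈ T ↔ a x = true := by
      intro x
      constructor
      · intro hx
        have := hTE hx
        simpa [Lit.rename, Lit.Holds, hν.apply_inl] using this
      · intro hx
        refine hT.mem_of_pos h𝒮 hc hΛ (fun v hv => hTE hv) ?_
        simpa [Lit.Holds, hν.apply_inl] using hx
    refine ⟨hT.eval (fun x => (ht x).1) _ hT.root_mem, fun i => ?_⟩
    obtain ⟨x, ⟨hi, hx⟩, hu⟩ := hT.leaf i
    exact ⟨x, ⟨hi, (ht x).1 hx⟩, fun x' hx' => hu x' ⟨hx'.1, (ht x').2 hx'.2⟩⟩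

theorem isURCEncoding_withSeparators [Finite ι] [∀ i, Finite (κ i)] [Finite W] [Finite Y]
    (hdec : D.Decomposable) (hsmooth : D.Smooth)
    (hν : IsVarSplit ν y) (h𝒮 : D.IsSeparatorCover 𝒮)
    (hc : ∀ S, AmoGadget (c S) (fun v : {v // v ∈ S.1} => ν v) (y S) (b S)) :
    IsURCEncoding (D.withSeparators ν c) D.fn' := by
  refine ⟨isEncoding_withSeparators hdec hsmooth hν h𝒮 hc, urcOn_univ_of_closed fun Λ hΛ => ?_⟩
  obtain ⟨T, hTE, hT⟩ := exists_certificate hdec hsmooth (satisfied_of_closed (closed_base hΛ))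
  obtain ⟨a, ha, hl, -⟩ := hT.exists_model_of_closed hν h𝒮 hc hΛ fun v hv => hTE hv
  exact ⟨a, ha, hl⟩

theorem isPCEncoding_withSeparators [Finite ι] [∀ i, Finite (κ i)] [Finite W] [Finite Y]
    (hdec : D.Decomposable) (hsmooth : D.Smooth)
    (hν : IsVarSplit ν y) (h𝒮 : D.IsSeparatorCover 𝒮)
    (hc : ∀ S, EoGadget (c S) (fun v : {v // v ∈ S.1} => ν v) (y S) (b S)) :
    IsPCEncoding (D.withSeparators ν c) D.fn' := by
  have hc' := fun S => (hc S).toAmoGadget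
  refine ⟨isEncoding_withSeparators hdec hsmooth hν h𝒮 hc', pcOn_univ_of_closed fun Λ hΛ k hk => ?_⟩
  have hbase := closed_base hΛ
  have hsat := satisfied_of_closed hbase
  -- Every node that is not falsified belongs to a certificate that yields a model.
  have hex : ∀ v, .neg (ν v) ∉ Λ → ∃ T, D.IsCertificate T ∧ v ∈ T ∧
      ∃ a, (D.withSeparators ν c).Holds a ∧ (∀ l ∈ Λ, l.Holds a) ∧
        (∀ v, a (ν v) = true ↔ v ∈ T) ∧
        ∀ S (u : {v // v ∈ S.1}), u.1 ∈ T → ∀ j, a (y S j) = b S u j := by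
    intro v hv
    obtain ⟨T, hTE, hT, hvT⟩ := exists_certificate_mem hdec hsmooth hsat (fun v hv hne =>
      exists_edge_of_closed hbase hv (exists_edge (by
        rintro x rfl
        exact mem_leaves_of_closed hbase hv) hne)) (v := v) hv
    exact ⟨T, hT, hvT, hT.exists_model_of_closed hν h𝒮 hc' hΛ fun v hv => hTE hv⟩
  rcases k with z | z
  · rcases hν.cover z with ⟨v, rfl⟩ | ⟨S, j, rfl⟩
    · by_cases hr : v = D.root
      · subst hr
        exact absurd (hbase.unit (Or.inr rfl) : Lit.pos D.root ∈ _) hk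
      by_cases hv : ∀ x, v = Sum.inl x → x ∈ D.leaves
      · obtain ⟨S, hS⟩ := exists_sep_mem h𝒮 hv hr
        obtain ⟨u, hne, hu⟩ := (hc S).exists_ne Λ (closed_separator hΛ S) ⟨v, hS⟩ hk
        obtain ⟨T, hT, huT, a, ha, hl, haT, -⟩ := hex u hu
        refine ⟨a, ha, hl, fun h => hne (Subtype.ext ?_)⟩
        exact (hT.existsUnique_mem h𝒮 S).unique ⟨u.2, huT⟩ ⟨hS, (haT v).1 h⟩
      · push Not at hv
        obtain ⟨x, rfl, hx⟩ := hv
        obtain ⟨T, hT, -, a, ha, hl, haT, -⟩ := hex D.root hsat.root_mem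
        exact ⟨a, ha, hl, fun h => hx (hT.mem_leaves x ((haT _).1 h))⟩
    · obtain ⟨u, hu, hb⟩ := (hc S).exists_false Λ (closed_separator hΛ S) j hk
      obtain ⟨T, -, huT, a, ha, hl, -, hy⟩ := hex u hu
      exact ⟨a, ha, hl, by simp [Lit.Holds, hy S u huT, hb]⟩
  · rcases hν.cover z with ⟨v, rfl⟩ | ⟨S, j, rfl⟩
    · obtain ⟨T, -, hvT, a, ha, hl, haT, -⟩ := hex v hk
      exact ⟨a, ha, hl, by simp [Lit.Holds, (haT v).2 hvT]⟩
    · obtain ⟨u, hu, hb⟩ := (hc S).exists_true Λ (closed_separator hΛ S) j hk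
      obtain ⟨T, -, huT, a, ha, hl, -, hy⟩ := hex u hu
      exact ⟨a, ha, hl, by simp [Lit.Holds, hy S u huT, hb]⟩

end

/-! ### The four encodings -/

theorem isVarSplit_id : IsVarSplit (𝒮 := 𝒮) (J := fun _ => Fin 0)
    (id : DVar ι κ ⊕ W → DVar ι κ ⊕ W) (fun _ j => j.elim0) where
  apply_inl _ := rfl
  exists_glue f _ := ⟨f, fun _ => rfl, fun _ j => j.elim0⟩
  cover z := Or.inl ⟨z, rfl⟩

theorem isVarSplit_nodeVar : IsVarSplit (nodeVar 𝒮) (zVar (𝒮 := 𝒮)) where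
  apply_inl _ := rfl
  exists_glue f g := by
    refine ⟨Sum.elim (f ∘ Sum.inl) (Sum.elim (f ∘ Sum.inr) fun z => g z.1 z.2), ?_, fun _ _ => rfl⟩
    rintro (x | w) <;> rfl
  cover := by
    rintro (x | w | ⟨S, j⟩)
    · exact Or.inl ⟨Sum.inl x, rfl⟩
    · exact Or.inl ⟨Sum.inr w, rfl⟩
    · exact Or.inr ⟨S, j, rfl⟩

theorem base_rename_id : D.base.rename id = D.base := by
  have : (Lit.rename id : Lit (DVar ι κ ⊕ W) → Lit (DVar ι κ ⊕ W)) = id := by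
    funext l; cases l <;> rfl
  simp [CNF.rename, this]

theorem withSeparators_id (f : Finset (DVar ι κ ⊕ W) → CNF (DVar ι κ ⊕ W)) :
    D.withSeparators id (fun S : Sep 𝒮 => f S.1) = D.base ∪ {C | ∃ i, ∃ S ∈ 𝒮 i, C ∈ f S} := by
  rw [withSeparators, base_rename_id]
  congr 1
  ext C
  constructor
  · rintro ⟨⟨S, i, hS⟩, hC⟩
    exact ⟨i, S, hS, hC⟩
  · rintro ⟨i, S, hS, hC⟩
    exact ⟨⟨S, i, hS⟩, hC⟩

theorem isURCEncoding_psiC [Finite ι] [∀ i, Finite (κ i)] [Finite W]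
    (hdec : D.Decomposable) (hsmooth : D.Smooth) (h𝒮 : D.IsSeparatorCover 𝒮) :
    IsURCEncoding (D.psiC 𝒮) D.fn' := by
  rw [psiC, ← withSeparators_id fun S => amoRep (S : Set (DVar ι κ ⊕ W))]
  exact isURCEncoding_withSeparators hdec hsmooth isVarSplit_id h𝒮 fun S =>
    amoGadget_amoRep (S.1 : Set (DVar ι κ ⊕ W)) _

theorem isPCEncoding_psiP [Finite ι] [∀ i, Finite (κ i)] [Finite W]
    (hdec : D.Decomposable) (hsmooth : D.Smooth) (h𝒮 : D.IsSeparatorCover 𝒮) :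
    IsPCEncoding (D.psiP 𝒮) D.fn' := by
  rw [psiP, ← withSeparators_id fun S => eoRep (S : Set (DVar ι κ ⊕ W))]
  exact isPCEncoding_withSeparators hdec hsmooth isVarSplit_id h𝒮 fun S =>
    eoGadget_eoRep (S.1 : Set (DVar ι κ ⊕ W)) _

theorem isURCEncoding_psiC' [Finite ι] [∀ i, Finite (κ i)] [Finite W]
    (hdec : D.Decomposable) (hsmooth : D.Smooth) (h𝒮 : D.IsSeparatorCover 𝒮)
    (enum : ∀ S : Sep 𝒮, Fin S.1.card ≃ {v // v ∈ S.1}) :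
    IsURCEncoding (D.psiC' 𝒮 enum) D.fn' := by
  refine isURCEncoding_withSeparators hdec hsmooth isVarSplit_nodeVar h𝒮
    (b := fun S => prefixVal _ ∘ (enum S).symm) fun S => ?_
  have h := (amoGadget_mu S.1.card (fun k => nodeVar 𝒮 (enum S k).1) (zVar S)).reindex
    (enum S).symm
  simpa [Function.comp_def] using h

theorem isPCEncoding_psiP' [Finite ι] [∀ i, Finite (κ i)] [Finite W]
    (hdec : D.Decomposable) (hsmooth : D.Smooth) (h𝒮 : D.IsSeparatorCover 𝒮)
    (enum : ∀ S : Sep 𝒮, Fin S.1.card ≃ {v // v ∈ S.1}) :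
    IsPCEncoding (D.psiP' 𝒮 enum) D.fn' := by
  refine isPCEncoding_withSeparators hdec hsmooth isVarSplit_nodeVar h𝒮
    (b := fun S => prefixVal _ ∘ (enum S).symm) fun S => ?_
  have h := (eoGadget_eps S.1.card (fun k => nodeVar 𝒮 (enum S k).1) (zVar S)).reindex
    (enum S).symm
  simpa [Function.comp_def] using h

end NNF
end DNNFEnc

theorem mainTheorem1 {ι : Type*} {κ : ι → Type*} {W : Type*}
    [Finite ι] [∀ i, Finite (κ i)] [Finite W]
    (D : DNNFEnc.NNF ι κ W) (hdec : D.Decomposable) (hsmooth : D.Smooth)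
    (𝒮 : ι → Set (Finset (DNNFEnc.DVar ι κ ⊕ W))) (h𝒮 : D.IsSeparatorCover 𝒮)
    (enum enum' : ∀ S : DNNFEnc.Sep 𝒮, Fin S.1.card ≃ {v // v ∈ S.1}) :
    DNNFEnc.IsURCEncoding (D.psiC 𝒮) D.fn' ∧
    DNNFEnc.IsURCEncoding (D.psiC' 𝒮 enum) D.fn' ∧
    DNNFEnc.IsPCEncoding (D.psiP 𝒮) D.fn' ∧
    DNNFEnc.IsPCEncoding (D.psiP' 𝒮 enum') D.fn' :=
  ⟨DNNFEnc.NNF.isURCEncoding_psiC hdec hsmooth h𝒮,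
    DNNFEnc.NNF.isURCEncoding_psiC' hdec hsmooth h𝒮 enum,
    DNNFEnc.NNF.isPCEncoding_psiP hdec hsmooth h𝒮,
    DNNFEnc.NNF.isPCEncoding_psiP' hdec hsmooth h𝒮 enum'⟩
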